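/- Let $I=\{1,\dots,n\}$, let $a_J\ge 0$ ($J\subset I$) with $a_\emptyset=0$, $\sum_{J\subset I}a_J=1$, and let $\gamma_i>0$ ($i\in I$) with $\sum_{i}\gamma_i=1$. For $A\subset I$ put $\mathcal P_A=\{J\subset A: a_J>0\}$, $\mathcal P=\mathcal P_I$, $\alpha(A)=\sum_{J\in\mathcal P_A}a_J$, $\gamma(A)=\sum_{i\in A}\gamma_i$, and assume that every $i\in I$ belongs to some $J\in\mathcal P$. For $N\in\mathbb N$ let $\Sigma_N^i=\{1,\dots,\lfloor 2^{\gamma_iN}\rfloor\}$ (so $|\Sigma_N^i|=2^{\gamma_i N}$ whenever this is an integer), $\Sigma_{N,A}=\prod_{i\in A}\Sigma_N^i$, and for $\sigma\in\Sigma_{N,A}$, $J\subset A$ let $\sigma_J=(\sigma_i)_{i\in J}$. Let $X^J_{\tau}$ ($J\in\mathcal P$, $\tau\in\Sigma_{N,J}$) be independent centered Gaussian random variables with variance $a_JN$, and let $\mathbb P$ be the underlying probability. The hamiltonian is $X_\sigma=\sum_{J\in\mathcal P}X^J_{\sigma_J}$, $\sigma\in\Sigma_{N,I}$. *Chain.*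 For $B\subsetneq A$ let $\rho(B,A)=\sqrt{2\log 2\,\frac{\gamma(A)-\gamma(B)}{\alpha(A)-\alpha(B)}}$ (with value $+\infty$ if $\alpha(A)=\alpha(B)$) and $\hat\rho(B)=\min_{A\supsetneq B}\rho(B,A)$. Let $A_0=\emptyset$ and, as long as $A_{j-1}\ne I$, let $\beta_j=\hat\rho(A_{j-1})$ and let $A_j$ be the largest $A\supsetneq A_{j-1}$ with $\rho(A_{j-1},A)=\beta_j$ (the union of all such $A$). This gives a chain $\emptyset=A_0\subsetneq A_1\subsetneq\dots\subsetneq A_K=I$. *Irreducibility.* The hamiltonian is irreducible if - (c) for every $j=1,\dots,K$ and every $A\subsetneq A_j\setminus A_{j-1}$ with $\mathcal P_{A\cup A_{j-1}}\setminus\mathcal P_{A_{j-1}}\neq\emptyset$ there are $J\in\mathcal P_{A_j}\setminus\mathcal P_{A\cup A_{j-1}}$ and $J'\in\mathcal P_{A\cup A_{j-1}}\setminus\mathcal P_{A_{j-1}}$ with $(J\cap J')\setminus A_{j-1}\ne\emptyset$; and - (c$'$) for every $j=2,\dots,K$ there are $s\in A_{j-1}\setminus A_{j-2}$ and $J\in\mathcal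 P_{A_j}\setminus\mathcal P_{A_{j-1}}$ with $s\in J$. *Partial energies.* For $j=1,\dots,K$ put $\Delta_j=\alpha(A_j)-\alpha(A_{j-1})$ and $$a_{N,j}=\beta_j\Delta_jN-\frac1{2\beta_j}\log N+\frac1{\beta_j}\log\!\big(\beta_j\sqrt{2\pi\Delta_j}\big),$$ and for $\sigma\in\Sigma_{N,A_j}$ put $$\widehat X_{\sigma(1),\dots,\sigma(j)}=\sum_{l=1}^j\Big(\sum_{J\in\mathcal P_{A_l}\setminus\mathcal P_{A_{l-1}}}X^J_{\sigma_J}-a_{N,l}\Big).$$ *Non-ultrametric couples.* $\sigma,\tau\in\Sigma_{N,A_j}$ form a non-ultrametric couple if for some $k\in\{1,\dots,j\}$ there is $s\in A_k\setminus A_{k-1}$ with $\sigma_s=\tau_s$, while $\sigma_r\ne\tau_r$ for some $r\in A_k$. **Proposition.** Assume that the hamiltonian is irreducible. Let $1\le j\le K$, let $\Diamond\subset\mathbb R$ be compact and let $\varepsilon>0$. Then there is $N_0$ such that for all $N\ge N_0$ $$\mathbb P\Big[\exists\text{ a non-ultrametric couple }\sigma,\tau\in\Sigma_{N,A_j}:\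 \widehat X_{\sigma(1),\dots,\sigma(j)}\in\Diamond\ \text{and}\ \widehat X_{\tau(1),\dots,\tau(j)}\in\Diamond\Big]\le\varepsilon .$$ -/

import Mathlib

open MeasureTheory ProbabilityTheory Filter

noncomputable section

/-- Parameters of the nonhierarchical GREM on the index set `I = Fin n`: the weights `a J ≥ 0` of
the subsets `J` of `I` and the proportions `γ i > 0`. -/
structure GREM (n : ℕ) where
  a : Finset (Fin n) → ℝ
  γ : Fin n → ℝ
  a_nonneg : ∀ J, 0 ≤ a J
  a_empty : a ∅ = 0
  a_sum : ∑ J, a J = 1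
  γ_pos : ∀ i, 0 < γ i
  γ_sum : ∑ i, γ i = 1

namespace GREM

variable {n : ℕ} (M : GREM n)

open Classical in
/-- `𝒫_A`, the subsets of `A` of positive weight. -/
def P (A : Finset (Fin n)) : Finset (Finset (Fin n)) :=
  A.powerset.filter (fun J => 0 < M.a J)

/-- `α(A)`. -/
def alpha (A : Finset (Fin n)) : ℝ := ∑ J ∈ M.P A, M.a J

/-- `γ(A)`. -/
def gam (A : Finset (Fin n)) : ℝ := ∑ i ∈ A, M.γ i

/-- `ρ(B, A)`, for `B ⊆ A` with `α(B) < α(A)`. -/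
def rho (B A : Finset (Fin n)) : ℝ :=
  √(2 * Real.log 2 * ((M.gam A - M.gam B) / (M.alpha A - M.alpha B)))

/-- The sets over which `ρ(B, ·)` is minimised: the strict supersets `A` of `B` for which `ρ(B, A)`
is finite. -/
def Admissible (B A : Finset (Fin n)) : Prop := B ⊂ A ∧ M.alpha B < M.alpha A

/-- `ρ̂(B)`, the minimum of `ρ(B, A)` over the strict supersets `A` of `B`. -/
def rhoHat (B : Finset (Fin n)) : ℝ := sInf {r | ∃ A, M.Admissible B A ∧ r = M.rho B A}

open Classical in
/-- The union of all minimisers of `ρ(B, ·)`, that is, the largest minimiser. -/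
def next (B : Finset (Fin n)) : Finset (Fin n) :=
  B ∪ (Finset.univ.filter (fun A => M.Admissible B A ∧ M.rho B A = M.rhoHat B)).sup id

/-- The chain `A_0 = ∅ ⊂ A_1 ⊂ ⋯ ⊂ A_K = I`; it is constant from `K` on. -/
def chain : ℕ → Finset (Fin n)
  | 0 => ∅
  | j + 1 => M.next (chain j)

/-- The length `K` of the chain, the first index at which it reaches `I`. -/
def K : ℕ := sInf {k | M.chain k = Finset.univ}

/-- The critical inverse temperatures `β_0 = 0`, `β_j = ρ̂(A_{j-1})`. -/
def beta : ℕ → ℝ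
  | 0 => 0
  | j + 1 => M.rhoHat (M.chain j)

/-- `𝒫_{A_j} \ 𝒫_{A_{j-1}}`, for `j ≥ 1`. -/
def level (j : ℕ) : Finset (Finset (Fin n)) := M.P (M.chain j) \ M.P (M.chain (j - 1))

/-- `Δ_j = α(A_j) - α(A_{j-1})`, for `j ≥ 1`. -/
def Delta (j : ℕ) : ℝ := M.alpha (M.chain j) - M.alpha (M.chain (j - 1))

/-- The centering `a_{N,j}`, for `j ≥ 1`. -/
def aN (N j : ℕ) : ℝ :=
  M.beta j * M.Delta j * N - 1 / (2 * M.beta j) * Real.log N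
    + 1 / M.beta j * Real.log (M.beta j * √(2 * Real.pi * M.Delta j))

/-- The first irreducibility condition. It concerns the `A ⊊ A_j \ A_{j-1}` for which
`𝒫_{A ∪ A_{j-1}} \ 𝒫_{A_{j-1}}` is not empty. -/
def CondC : Prop :=
  ∀ j, 1 ≤ j → j ≤ M.K → ∀ A, A ⊂ M.chain j \ M.chain (j - 1) →
    (M.P (A ∪ M.chain (j - 1)) \ M.P (M.chain (j - 1))).Nonempty →
      ∃ J ∈ M.P (M.chain j) \ M.P (A ∪ M.chain (j - 1)),
        ∃ J' ∈ M.P (A ∪ M.chain (j - 1)) \ M.P (M.chain (j - 1)),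
          ((J ∩ J') \ M.chain (j - 1)).Nonempty

/-- The second irreducibility condition. -/
def CondC' : Prop :=
  ∀ j, 2 ≤ j → j ≤ M.K →
    ∃ s ∈ M.chain (j - 1) \ M.chain (j - 2), ∃ J ∈ M.level j, s ∈ J

/-- Irreducibility of the hamiltonian. -/
def Irreducible : Prop := M.CondC ∧ M.CondC'

/-- The number of elements of `Σ_N^i`; it is `2 ^ (γ_i N)` whenever this is an integer. -/
def size (N : ℕ) (i : Fin n) : ℕ := ⌊(2 : ℝ) ^ (M.γ i * N)⌋₊

/-- The configurations `Σ_{N,A}`. -/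
abbrev Conf (N : ℕ) (A : Finset (Fin n)) : Type := (i : A) → Fin (M.size N i)

lemma chain_mono : Monotone M.chain :=
  monotone_nat_of_le_succ fun _ => Finset.subset_union_left

lemma subset_of_mem_level {j : ℕ} {J : Finset (Fin n)} (h : J ∈ M.level j) : J ⊆ M.chain j := by
  simp only [level, P, Finset.mem_sdiff, Finset.mem_filter, Finset.mem_powerset] at h
  exact h.1.1

variable {Ω : Type*} {N : ℕ}

/-- At size `N`, the variables `X J τ`, for `J ∈ 𝒫` and `τ ∈ Σ_{N,J}`, are independent centered
gaussians of variance `a_J N`. -/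
structure IsDisorder [MeasurableSpace Ω] (Pr : Measure Ω)
    (X : (J : Finset (Fin n)) → M.Conf N J → Ω → ℝ) : Prop where
  hasLaw : ∀ J ∈ M.P Finset.univ, ∀ τ : M.Conf N J,
    HasLaw (X J τ) (gaussianReal 0 (M.a J * N).toNNReal) Pr
  indep : iIndepFun
    (fun p : (Σ J : {J // J ∈ M.P Finset.univ}, M.Conf N J.1) => X p.1.1 p.2) Pr

/-- `X_{σ(1),…,σ(l)}` for `σ ∈ Σ_{N,A_l}`. -/
def energy (X : (J : Finset (Fin n)) → M.Conf N J → Ω → ℝ) (l : ℕ) (σ : M.Conf N (M.chain l))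
    (ω : Ω) : ℝ :=
  ∑ J : {J // J ∈ M.level l},
    X J.1 (Finset.restrict₂ (π := fun i => Fin (M.size N i)) (M.subset_of_mem_level J.2) σ) ω

/-- The centered energy `X̄_{σ(1),…,σ(l)}`. -/
def energyBar (X : (J : Finset (Fin n)) → M.Conf N J → Ω → ℝ) (l : ℕ)
    (σ : M.Conf N (M.chain l)) (ω : Ω) : ℝ :=
  M.energy X l σ ω - M.aN N l

/-- The partial energy `X̂_{σ(1),…,σ(j)}`, the sum of the centered energies of the levels
`1, …, j`. -/
def energyHat (X : (J : Finset (Fin n)) → M.Conf N J → Ω → ℝ) (j : ℕ)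
    (σ : M.Conf N (M.chain j)) (ω : Ω) : ℝ :=
  ∑ l : {l // l ∈ Finset.Icc 1 j},
    M.energyBar X l.1
      (Finset.restrict₂ (π := fun i => Fin (M.size N i))
        (M.chain_mono (Finset.mem_Icc.mp l.2).2) σ) ω

/-- `σ, τ ∈ Σ_{N,A_j}` agree at some site of `A_k \ A_{k-1}` but differ at some site of `A_k`, for
some `1 ≤ k ≤ j`. -/
def Nonultrametric (j : ℕ) (σ τ : M.Conf N (M.chain j)) : Prop :=
  ∃ k, 1 ≤ k ∧ k ≤ j ∧
    (∃ s : M.chain j, s.1 ∈ M.chain k \ M.chain (k - 1) ∧ σ s = τ s) ∧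
    (∃ r : M.chain j, r.1 ∈ M.chain k ∧ σ r ≠ τ r)

end GREM

end

/-
At the inverse temperature `β_l` the law of a centered energy of the `l`-th level is dominated by
`exp (-β_l x) dx` with a constant of order `2 ^ (-γ(A_l \ A_{l-1}) N)`, which compensates the number
of configurations of that level. Because the `β_l` increase strictly, the energies of the
configurations kept below a fixed height are dominated in the same way by `exp (-β_l x) dx` after
`l` levels. Two consequences are that, with high probability, every configuration with partial
energy in a given bounded set has bounded centered energies at all levels, and that the expected
number of configurations with bounded energies stays bounded in `N`.

Let `k` be the first level at which two configurations violate ultrametricity. Below `k` they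
agree on some `A_r` and nowhere else, and at level `k` they agree exactly on a nonempty set `S` of
new sites. Having the sites of `S` in common reduces the number of pairs by a factor
`2 ^ (-γ(S) N)`. If no level-`k` variable is common to the two configurations, then their
level-`k` energies are independent and this factor makes the expected number of pairs small.
Otherwise it is compensated by the common energy, which cannot exceed a cut of order `N`, up to a
small probability, by the first moment over the sites of `A_{k-1} ∪ S`. Below the cut the expected
number of pairs is `O(1 / √N)`, the factor `1 / √N` being the normalisation of the gaussian
density of the common energy: those of the two remainders are absorbed by the logarithms in
`a_{N,k}`. Irreducibility and the minimality in `ρ̂` ensure that the two remainders do not vanish.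
-/

noncomputable section

namespace GREM

variable {n : ℕ} (M : GREM n)

lemma mem_P {A J : Finset (Fin n)} : J ∈ M.P A ↔ J ⊆ A ∧ 0 < M.a J := by
  simp [P]

lemma P_mono {A B : Finset (Fin n)} (h : A ⊆ B) : M.P A ⊆ M.P B := fun J hJ => by
  rw [mem_P] at *
  exact ⟨hJ.1.trans h, hJ.2⟩

lemma alpha_mono {A B : Finset (Fin n)} (h : A ⊆ B) : M.alpha A ≤ M.alpha B :=
  Finset.sum_le_sum_of_subset_of_nonneg (M.P_mono h) fun J _ _ => M.a_nonneg J

lemma alpha_sub_alpha {A B : Finset (Fin n)} (h : A ⊆ B) :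
    M.alpha B - M.alpha A = ∑ J ∈ M.P B \ M.P A, M.a J := by
  rw [alpha, alpha, ← Finset.sum_sdiff (M.P_mono h), add_sub_cancel_right]

lemma gam_sub_gam {A B : Finset (Fin n)} (h : A ⊆ B) : M.gam B - M.gam A = M.gam (B \ A) := by
  rw [gam, gam, gam, ← Finset.sum_sdiff h, add_sub_cancel_right]

lemma gam_pos {A : Finset (Fin n)} (h : A.Nonempty) : 0 < M.gam A :=
  Finset.sum_pos (fun i _ => M.γ_pos i) h

lemma gam_lt_gam {A B : Finset (Fin n)} (h : A ⊂ B) : M.gam A < M.gam B := by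
  rw [← sub_pos, M.gam_sub_gam h.1]
  exact M.gam_pos (Finset.sdiff_nonempty.2 h.2)

lemma alpha_add_alpha_le (A B : Finset (Fin n)) :
    M.alpha A + M.alpha B ≤ M.alpha (A ∪ B) + M.alpha (A ∩ B) := by
  have hinter : M.P A ∩ M.P B = M.P (A ∩ B) := by
    ext J
    simp only [Finset.mem_inter, mem_P, Finset.subset_inter_iff]
    tauto
  have hunion : M.P A ∪ M.P B ⊆ M.P (A ∪ B) :=
    Finset.union_subset (M.P_mono Finset.subset_union_left) (M.P_mono Finset.subset_union_right)
  rw [alpha, alpha, alpha, alpha, ← hinter, ← Finset.sum_union_inter]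
  gcongr
  exact fun J _ _ => M.a_nonneg J

lemma gam_add_gam (A B : Finset (Fin n)) :
    M.gam A + M.gam B = M.gam (A ∪ B) + M.gam (A ∩ B) :=
  Finset.sum_union_inter.symm

lemma gam_union {A B : Finset (Fin n)} (h : Disjoint A B) :
    M.gam (A ∪ B) = M.gam A + M.gam B :=
  Finset.sum_union h

lemma rho_sq_mul_alpha_sub {B A : Finset (Fin n)} (h : M.Admissible B A) :
    M.rho B A ^ 2 * (M.alpha A - M.alpha B) = 2 * Real.log 2 * (M.gam A - M.gam B) := by
  have hα : 0 < M.alpha A - M.alpha B := sub_pos.2 h.2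
  have hγ : 0 < M.gam A - M.gam B := sub_pos.2 (M.gam_lt_gam h.1)
  rw [rho, Real.sq_sqrt (by positivity)]
  field_simp

lemma rho_pos {B A : Finset (Fin n)} (h : M.Admissible B A) : 0 < M.rho B A := by
  have hα : 0 < M.alpha A - M.alpha B := sub_pos.2 h.2
  have hγ : 0 < M.gam A - M.gam B := sub_pos.2 (M.gam_lt_gam h.1)
  exact Real.sqrt_pos.2 (by positivity)

/-- The gap `2 log 2 (γ(A) - γ(B)) - r² (α(A) - α(B))`. For `r = ρ̂(B)` it is nonnegative on the
supersets `A` of `B` and vanishes at the minimisers of `ρ(B, ·)`; unlike `ρ(B, ·)` it also makes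
sense when `α(A) = α(B)`. -/
def excess (r : ℝ) (B A : Finset (Fin n)) : ℝ :=
  2 * Real.log 2 * (M.gam A - M.gam B) - r ^ 2 * (M.alpha A - M.alpha B)

@[simp]
lemma excess_self (r : ℝ) (B : Finset (Fin n)) : M.excess r B B = 0 := by
  simp [excess]

lemma excess_of_alpha_eq (r : ℝ) {B A : Finset (Fin n)} (h : M.alpha A = M.alpha B) :
    M.excess r B A = 2 * Real.log 2 * (M.gam A - M.gam B) := by
  simp [excess, h]

lemma excess_eq_mul (r : ℝ) {B A : Finset (Fin n)} (h : M.Admissible B A) :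
    M.excess r B A = (M.rho B A ^ 2 - r ^ 2) * (M.alpha A - M.alpha B) := by
  rw [excess, ← M.rho_sq_mul_alpha_sub h, sub_mul]

lemma excess_union_add_excess_inter_le (r : ℝ) (B A A' : Finset (Fin n)) :
    M.excess r B (A ∪ A') + M.excess r B (A ∩ A') ≤ M.excess r B A + M.excess r B A' := by
  have hα := mul_le_mul_of_nonneg_left (M.alpha_add_alpha_le A A') (sq_nonneg r)
  have hγ := congrArg (2 * Real.log 2 * ·) (M.gam_add_gam A A')
  simp only [excess] at *
  linarith

section Minimiser

variable (B : Finset (Fin n))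

lemma finite_setOf_rho : {r | ∃ A, M.Admissible B A ∧ r = M.rho B A}.Finite :=
  (Set.finite_range fun A => M.rho B A).subset (by rintro _ ⟨A, -, rfl⟩; exact ⟨A, rfl⟩)

lemma rhoHat_le_rho {B A : Finset (Fin n)} (h : M.Admissible B A) : M.rhoHat B ≤ M.rho B A :=
  csInf_le (M.finite_setOf_rho B).bddBelow ⟨A, h, rfl⟩

variable {B} (hcover : ∀ i : Fin n, ∃ J ∈ M.P Finset.univ, i ∈ J) (hB : B ≠ Finset.univ)

include hcover hB

lemma admissible_univ : M.Admissible B Finset.univ := by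
  have hB' : B ⊂ Finset.univ := Finset.ssubset_univ_iff.2 hB
  obtain ⟨i, -, hi⟩ := Finset.exists_of_ssubset hB'
  obtain ⟨J, hJ, hiJ⟩ := hcover i
  exact ⟨hB', Finset.sum_lt_sum_of_subset (M.P_mono hB'.1) hJ
    (fun h => hi ((M.mem_P.1 h).1 hiJ)) (M.mem_P.1 hJ).2 fun J _ _ => M.a_nonneg J⟩

lemma exists_rho_eq_rhoHat : ∃ A, M.Admissible B A ∧ M.rho B A = M.rhoHat B := by
  have hne : {r | ∃ A, M.Admissible B A ∧ r = M.rho B A}.Nonempty :=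
    ⟨_, _, M.admissible_univ hcover hB, rfl⟩
  obtain ⟨A, hA, h⟩ := hne.csInf_mem (M.finite_setOf_rho B)
  exact ⟨A, hA, h.symm⟩

lemma rhoHat_pos : 0 < M.rhoHat B := by
  obtain ⟨A, hA, h⟩ := M.exists_rho_eq_rhoHat hcover hB
  exact h ▸ M.rho_pos hA

lemma excess_rhoHat_nonneg {A : Finset (Fin n)} (hA : B ⊆ A) :
    0 ≤ M.excess (M.rhoHat B) B A := by
  rcases hA.eq_or_ssubset with rfl | hBA
  · simp
  have hγ : 0 < M.gam A - M.gam B := sub_pos.2 (M.gam_lt_gam hBA)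
  rcases (M.alpha_mono hA).eq_or_lt with hα | hα
  · rw [M.excess_of_alpha_eq _ hα.symm]
    positivity
  · have hsq := pow_le_pow_left₀ (M.rhoHat_pos hcover hB).le (M.rhoHat_le_rho ⟨hBA, hα⟩) 2
    rw [M.excess_eq_mul _ ⟨hBA, hα⟩]
    exact mul_nonneg (sub_nonneg.2 hsq) (sub_nonneg.2 hα.le)

lemma rho_eq_rhoHat_iff_excess_eq_zero {A : Finset (Fin n)} (hA : B ⊂ A) :
    (M.Admissible B A ∧ M.rho B A = M.rhoHat B) ↔ M.excess (M.rhoHat B) B A = 0 := by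
  refine ⟨fun ⟨hadm, h⟩ => by simp [M.excess_eq_mul _ hadm, h], fun h => ?_⟩
  have hγ : 0 < M.gam A - M.gam B := sub_pos.2 (M.gam_lt_gam hA)
  have hα : M.alpha B < M.alpha A := by
    refine (M.alpha_mono hA.1).lt_of_ne fun hα => ne_of_gt ?_ h
    rw [M.excess_of_alpha_eq _ hα.symm]
    positivity
  have hadm : M.Admissible B A := ⟨hA, hα⟩
  rw [M.excess_eq_mul _ hadm, mul_eq_zero, or_iff_left (sub_pos.2 hα).ne', sub_eq_zero] at h
  exact ⟨hadm, (pow_left_inj₀ (M.rho_pos hadm).le (M.rhoHat_pos hcover hB).le two_ne_zero).1 h⟩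

lemma excess_union_eq_zero {A A' : Finset (Fin n)} (hA : B ⊆ A) (hA' : B ⊆ A')
    (h : M.excess (M.rhoHat B) B A = 0) (h' : M.excess (M.rhoHat B) B A' = 0) :
    M.excess (M.rhoHat B) B (A ∪ A') = 0 := by
  have hinter := M.excess_rhoHat_nonneg hcover hB (Finset.subset_inter hA hA')
  have hunion := M.excess_rhoHat_nonneg hcover hB (hA.trans (Finset.subset_union_left (s₂ := A')))
  have hadd := M.excess_union_add_excess_inter_le (M.rhoHat B) B A A'
  linarith

lemma excess_next : M.excess (M.rhoHat B) B (M.next B) = 0 := by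
  classical
  have hsup : ∀ s : Finset (Finset (Fin n)),
      (∀ A ∈ s, M.Admissible B A ∧ M.rho B A = M.rhoHat B) →
      M.excess (M.rhoHat B) B (B ∪ s.sup id) = 0 := by
    intro s
    induction s using Finset.induction_on with
    | empty => simp
    | insert A s _ ih =>
      intro h
      have hA := h A (Finset.mem_insert_self _ _)
      rw [Finset.sup_insert, id, Finset.sup_eq_union, Finset.union_left_comm]
      exact M.excess_union_eq_zero hcover hB hA.1.1.1 Finset.subset_union_left
        ((M.rho_eq_rhoHat_iff_excess_eq_zero hcover hB hA.1.1).1 hA)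
        (ih fun A' hA' => h A' (Finset.mem_insert_of_mem hA'))
  rw [next]
  convert hsup _ fun A hA => ?_
  simpa using hA

lemma subset_next {A : Finset (Fin n)} (hA : B ⊂ A) (h : M.excess (M.rhoHat B) B A = 0) :
    A ⊆ M.next B := by
  classical
  refine Finset.Subset.trans (Finset.le_sup (f := id) ?_) Finset.subset_union_right
  simpa using (M.rho_eq_rhoHat_iff_excess_eq_zero hcover hB hA).2 h

lemma ssubset_next : B ⊂ M.next B := by
  obtain ⟨A, hA⟩ := M.exists_rho_eq_rhoHat hcover hB
  exact hA.1.1.trans_subset (M.subset_next hcover hB hA.1.1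
    ((M.rho_eq_rhoHat_iff_excess_eq_zero hcover hB hA.1.1).1 hA))

lemma rhoHat_lt_rhoHat_next (h : M.next B ≠ Finset.univ) : M.rhoHat B < M.rhoHat (M.next B) := by
  obtain ⟨A, hA, hρ⟩ := M.exists_rho_eq_rhoHat hcover h
  have hBA : B ⊂ A := (M.ssubset_next hcover hB).trans hA.1
  have hpos : 0 < M.excess (M.rhoHat B) B A :=
    (M.excess_rhoHat_nonneg hcover hB hBA.1).lt_of_ne fun hzero =>
      hA.1.2 (M.subset_next hcover hB hBA hzero.symm)
  have hzero := M.excess_next hcover hB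
  have hA_eq := M.rho_sq_mul_alpha_sub hA
  rw [hρ] at hA_eq
  have hmul : M.rhoHat B ^ 2 * (M.alpha A - M.alpha (M.next B)) <
      M.rhoHat (M.next B) ^ 2 * (M.alpha A - M.alpha (M.next B)) := by
    simp only [excess] at hpos hzero
    linarith
  exact lt_of_pow_lt_pow_left₀ 2 (M.rhoHat_pos hcover h).le
    (lt_of_mul_lt_mul_right hmul (sub_pos.2 hA.2).le)

end Minimiser

section Chain

/-- The sites `A_l \ A_{l-1}` of the `l`-th level, for `l ≥ 1`. -/
def block (l : ℕ) : Finset (Fin n) := M.chain l \ M.chain (l - 1)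

lemma chain_sub_one_subset (l : ℕ) : M.chain (l - 1) ⊆ M.chain l :=
  M.chain_mono (Nat.sub_le l 1)

lemma chain_sub_one_union_block (l : ℕ) : M.chain (l - 1) ∪ M.block l = M.chain l :=
  Finset.union_sdiff_of_subset (M.chain_sub_one_subset l)

lemma chain_ne_univ {l : ℕ} (h : l < M.K) : M.chain l ≠ Finset.univ :=
  Nat.notMem_of_lt_sInf (s := {k | M.chain k = Finset.univ}) h

lemma beta_eq_rhoHat {l : ℕ} (hl : 1 ≤ l) : M.beta l = M.rhoHat (M.chain (l - 1)) := by
  obtain ⟨l, rfl⟩ := Nat.exists_eq_add_of_le' hl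
  rfl

lemma chain_eq_next {l : ℕ} (hl : 1 ≤ l) : M.chain l = M.next (M.chain (l - 1)) := by
  obtain ⟨l, rfl⟩ := Nat.exists_eq_add_of_le' hl
  rfl

lemma Delta_eq_sum (l : ℕ) : M.Delta l = ∑ J ∈ M.level l, M.a J :=
  M.alpha_sub_alpha (M.chain_sub_one_subset l)

variable (hcover : ∀ i : Fin n, ∃ J ∈ M.P Finset.univ, i ∈ J) {l : ℕ} (hl : 1 ≤ l)

include hcover hl

lemma beta_lt_beta_succ (hK : l + 1 ≤ M.K) : M.beta l < M.beta (l + 1) := by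
  rw [M.beta_eq_rhoHat hl, M.beta_eq_rhoHat (by omega), Nat.add_sub_cancel]
  have h := M.rhoHat_lt_rhoHat_next hcover (M.chain_ne_univ (l := l - 1) (by omega))
  rw [← M.chain_eq_next hl] at h
  exact h (M.chain_ne_univ (by omega))

variable (hK : l ≤ M.K)

include hK

lemma beta_pos : 0 < M.beta l := by
  rw [M.beta_eq_rhoHat hl]
  exact M.rhoHat_pos hcover (M.chain_ne_univ (by omega))

lemma excess_beta_nonneg {A : Finset (Fin n)} (hA : M.chain (l - 1) ⊆ A) :
    0 ≤ M.excess (M.beta l) (M.chain (l - 1)) A := by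
  rw [M.beta_eq_rhoHat hl]
  exact M.excess_rhoHat_nonneg hcover (M.chain_ne_univ (by omega)) hA

lemma beta_sq_mul_Delta : M.beta l ^ 2 * M.Delta l = 2 * Real.log 2 * M.gam (M.block l) := by
  have h := M.excess_next hcover (M.chain_ne_univ (l := l - 1) (by omega))
  rw [← M.chain_eq_next hl, ← M.beta_eq_rhoHat hl, excess, sub_eq_zero,
    M.gam_sub_gam (M.chain_sub_one_subset l)] at h
  exact h.symm

lemma block_nonempty : (M.block l).Nonempty := by
  have h := M.ssubset_next hcover (M.chain_ne_univ (l := l - 1) (by omega))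
  rw [← M.chain_eq_next hl] at h
  exact Finset.sdiff_nonempty.2 h.2

lemma Delta_pos : 0 < M.Delta l := by
  have hγ := M.gam_pos (M.block_nonempty hcover hl hK)
  have hmul : 0 < M.beta l ^ 2 * M.Delta l := by
    rw [M.beta_sq_mul_Delta hcover hl hK]
    positivity
  exact pos_of_mul_pos_right hmul (sq_nonneg _)

end Chain

end GREM

section ExponentialMeasure

/-- The measure `exp (-b x) dx` on the real line. It dominates the centered gaussian laws, and
being an eigenmeasure of translations it is multiplied by a constant under convolution. -/
def expWeight (b : ℝ) : Measure ℝ :=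
  volume.withDensity fun x => ENNReal.ofReal (Real.exp (-b * x))

instance (b : ℝ) : SFinite (expWeight b) := by
  unfold expWeight
  infer_instance

lemma expWeight_Ici {b : ℝ} (hb : 0 < b) (t : ℝ) :
    expWeight b (Set.Ici t) = ENNReal.ofReal (Real.exp (-b * t) / b) := by
  rw [expWeight, withDensity_apply _ measurableSet_Ici, setLIntegral_congr Ioi_ae_eq_Ici.symm,
    ← ofReal_integral_eq_lintegral_ofReal (integrableOn_exp_mul_Ioi (neg_lt_zero.2 hb) t)
    (ae_of_all _ fun x => (Real.exp_pos _).le), integral_exp_mul_Ioi (neg_lt_zero.2 hb),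
    neg_div_neg_eq]

lemma expWeight_Icc_le {b : ℝ} (hb : 0 ≤ b) (p q : ℝ) :
    expWeight b (Set.Icc p q) ≤ ENNReal.ofReal (Real.exp (-b * p) * (q - p)) := by
  rw [expWeight, withDensity_apply _ measurableSet_Icc, ENNReal.ofReal_mul (Real.exp_pos _).le,
    ← Real.volume_Icc, ← setLIntegral_const]
  refine setLIntegral_mono' measurableSet_Icc fun z hz => ?_
  gcongr ENNReal.ofReal (Real.exp ?_)
  exact mul_le_mul_of_nonpos_left hz.1 (neg_nonpos.2 hb)

lemma expWeight_preimage_const_add (b s : ℝ) {E : Set ℝ} (hE : MeasurableSet E) :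
    expWeight b ((s + ·) ⁻¹' E) = ENNReal.ofReal (Real.exp (b * s)) * expWeight b E := by
  rw [expWeight, withDensity_apply _ hE, withDensity_apply _ (measurable_const_add s hE),
    ← lintegral_const_mul _ (by fun_prop),
    ← (measurePreserving_add_left volume s).setLIntegral_comp_preimage hE (by fun_prop)]
  refine setLIntegral_congr_fun (measurable_const_add s hE) fun x _ => ?_
  rw [← ENNReal.ofReal_mul (Real.exp_pos _).le, ← Real.exp_add]
  ring_nf

lemma conv_expWeight (μ : Measure ℝ) (b : ℝ) :
    μ ∗ expWeight b = (∫⁻ x, ENNReal.ofReal (Real.exp (b * x)) ∂μ) • expWeight b := by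
  ext E hE
  rw [Measure.conv, Measure.map_apply measurable_add hE, Measure.prod_apply (measurable_add hE),
    Measure.smul_apply, smul_eq_mul, ← lintegral_mul_const _ (by fun_prop)]
  exact lintegral_congr fun x => expWeight_preimage_const_add b x hE

lemma setLIntegral_exp_expWeight {b b' : ℝ} (h : b < b') (t : ℝ) :
    ∫⁻ x in Set.Iic t, ENNReal.ofReal (Real.exp (b' * x)) ∂(expWeight b) =
      ENNReal.ofReal (Real.exp ((b' - b) * t) / (b' - b)) := by
  have hpos := sub_pos.2 h
  rw [← integral_exp_mul_Iic hpos, ofReal_integral_eq_lintegral_ofReal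
    (integrableOn_exp_mul_Iic hpos t) (ae_of_all _ fun x => (Real.exp_pos _).le), expWeight,
    setLIntegral_withDensity_eq_setLIntegral_mul _ (by fun_prop) (by fun_prop) measurableSet_Iic]
  refine setLIntegral_congr_fun measurableSet_Iic fun x _ => ?_
  rw [Pi.mul_apply, ← ENNReal.ofReal_mul (Real.exp_pos _).le, ← Real.exp_add]
  ring_nf

/-- The constant with which `expWeight b` dominates the centered gaussian law of variance `v`. -/
def gaussConst (b v : ℝ) : ℝ := (√(2 * Real.pi * v))⁻¹ * Real.exp (b ^ 2 * v / 2)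

lemma gaussConst_nonneg (b v : ℝ) : 0 ≤ gaussConst b v := by
  unfold gaussConst
  positivity

lemma gaussianReal_le_expWeight (b : ℝ) {v : ℝ} (hv : 0 < v) :
    gaussianReal 0 v.toNNReal ≤ ENNReal.ofReal (gaussConst b v) • expWeight b := by
  rw [gaussianReal_of_var_ne_zero 0 (by simpa using hv), expWeight,
    ← withDensity_smul _ (by fun_prop)]
  refine withDensity_mono (ae_of_all _ fun x => ?_)
  rw [Pi.smul_apply, smul_eq_mul, ← ENNReal.ofReal_mul (gaussConst_nonneg b v), gaussianPDF,
    gaussianPDFReal, gaussConst, Real.coe_toNNReal v hv.le, mul_assoc (√_)⁻¹,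
    ← Real.exp_add]
  gcongr
  rw [sub_zero, div_le_iff₀ (by positivity)]
  nlinarith [sq_nonneg (x - b * v)]

section Domination

variable {μ ν : Measure ℝ} {c c' b b' : ℝ}

lemma measureReal_le_mul_of_le_expWeight (hc : 0 ≤ c)
    (hμ : μ ≤ ENNReal.ofReal c • expWeight b) {E : Set ℝ} {x : ℝ} (hx : 0 ≤ x)
    (hE : expWeight b E ≤ ENNReal.ofReal x) : μ.real E ≤ c * x := by
  refine ENNReal.toReal_le_of_le_ofReal (mul_nonneg hc hx) ((hμ E).trans ?_)
  rw [Measure.smul_apply, smul_eq_mul, ENNReal.ofReal_mul hc]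
  gcongr

lemma measureReal_Ici_le_of_le_expWeight (hb : 0 < b) (hc : 0 ≤ c)
    (hμ : μ ≤ ENNReal.ofReal c • expWeight b) (t : ℝ) :
    μ.real (Set.Ici t) ≤ c * (Real.exp (-b * t) / b) :=
  measureReal_le_mul_of_le_expWeight hc hμ (by positivity) (expWeight_Ici hb t).le

lemma measureReal_Icc_le_of_le_expWeight (hb : 0 ≤ b) (hc : 0 ≤ c)
    (hμ : μ ≤ ENNReal.ofReal c • expWeight b) {p q : ℝ} (hpq : p ≤ q) :
    μ.real (Set.Icc p q) ≤ c * (Real.exp (-b * p) * (q - p)) :=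
  measureReal_le_mul_of_le_expWeight hc hμ
    (mul_nonneg (Real.exp_pos _).le (sub_nonneg.2 hpq)) (expWeight_Icc_le hb p q)

lemma map_const_add_le_expWeight (hc : 0 ≤ c) (hμ : μ ≤ ENNReal.ofReal c • expWeight b) (s : ℝ) :
    μ.map (s + ·) ≤ ENNReal.ofReal (c * Real.exp (b * s)) • expWeight b := by
  refine Measure.le_iff.2 fun E hE => ?_
  rw [Measure.map_apply (measurable_const_add s) hE]
  refine (hμ _).trans_eq ?_
  rw [Measure.smul_apply, Measure.smul_apply, expWeight_preimage_const_add b s hE, smul_eq_mul,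
    smul_eq_mul, ENNReal.ofReal_mul hc, mul_assoc]

lemma conv_restrict_Iic_le_expWeight (hc : 0 ≤ c) (hb : b < b')
    (hμ : μ ≤ ENNReal.ofReal c • expWeight b) (hν : ν ≤ ENNReal.ofReal c' • expWeight b')
    (t : ℝ) :
    μ.restrict (Set.Iic t) ∗ ν ≤
      ENNReal.ofReal (c * c' * (Real.exp ((b' - b) * t) / (b' - b))) • expWeight b' := by
  have hlaplace : ∫⁻ x in Set.Iic t, ENNReal.ofReal (Real.exp (b' * x)) ∂μ ≤
      ENNReal.ofReal (c * (Real.exp ((b' - b) * t) / (b' - b))) := by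
    refine (lintegral_mono' (Measure.restrict_mono le_rfl hμ) le_rfl).trans_eq ?_
    rw [Measure.restrict_smul, lintegral_smul_measure, setLIntegral_exp_expWeight hb, smul_eq_mul,
      ENNReal.ofReal_mul hc]
  have hfactor : 0 ≤ c * (Real.exp ((b' - b) * t) / (b' - b)) :=
    mul_nonneg hc (div_nonneg (Real.exp_pos _).le (sub_nonneg.2 hb.le))
  calc μ.restrict (Set.Iic t) ∗ ν
      ≤ μ.restrict (Set.Iic t) ∗ (ENNReal.ofReal c' • expWeight b') :=
        Measure.map_mono (Measure.prod_mono le_rfl hν) measurable_add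
    _ = (ENNReal.ofReal c' * ∫⁻ x in Set.Iic t, ENNReal.ofReal (Real.exp (b' * x)) ∂μ) •
          expWeight b' := by
        rw [Measure.conv_smul_right, conv_expWeight, smul_smul]
    _ ≤ (ENNReal.ofReal c' * ENNReal.ofReal (c * (Real.exp ((b' - b) * t) / (b' - b)))) •
          expWeight b' := by gcongr
    _ = _ := by
        rw [mul_comm, ← ENNReal.ofReal_mul hfactor, mul_right_comm]

end Domination

end ExponentialMeasure

section Independence

variable {Ω : Type*} {𝓖 : MeasurableSpace Ω} [m : MeasurableSpace Ω] {Pr : Measure Ω}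
  [IsProbabilityMeasure Pr]

lemma map_restrict_add_eq_conv_of_indep (h𝓖 : 𝓖 ≤ m) {G : Set Ω} (hG : MeasurableSet[𝓖] G)
    {S V : Ω → ℝ} (hS : Measurable[𝓖] S) (hV : Measurable V)
    (hind : Indep 𝓖 (MeasurableSpace.comap V inferInstance) Pr) :
    (Pr.restrict G).map (fun ω => S ω + V ω) = (Pr.restrict G).map S ∗ Pr.map V := by
  have hS' : Measurable S := hS.mono h𝓖 le_rfl
  have := Measure.isProbabilityMeasure_map hV.aemeasurable (μ := Pr)
  have hlaw : ((Pr.restrict G).map S).prod (Pr.map V) =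
      (Pr.restrict G).map fun ω => (S ω, V ω) := by
    refine Measure.prod_eq fun s t hs ht => ?_
    rw [Measure.map_apply (hS'.prodMk hV) (hs.prod ht), Measure.map_apply hS' hs,
      Measure.map_apply hV ht, Measure.restrict_apply (hS'.prodMk hV (hs.prod ht)),
      Measure.restrict_apply (hS' hs), Set.mk_preimage_prod, Set.inter_right_comm]
    exact (Indep_iff _ _ _).1 hind _ _ ((hS hs).inter hG) ⟨t, ht, rfl⟩
  rw [Measure.conv, hlaw, Measure.map_map measurable_add (hS'.prodMk hV)]
  rfl

lemma measure_biInter_eq_prod_of_indep {ι κ : Type*} {f : κ → Ω → ℝ} (hf : iIndepFun f Pr)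
    (hmeas : ∀ p, Measurable (f p)) {T : ι → Set κ} (hT : Pairwise (Function.onFun Disjoint T))
    {E : ι → Set Ω} (s : Finset ι)
    (hE : ∀ i ∈ s, MeasurableSet[⨆ p ∈ T i, MeasurableSpace.comap (f p) inferInstance] (E i)) :
    Pr (⋂ i ∈ s, E i) = ∏ i ∈ s, Pr (E i) := by
  classical
  induction s using Finset.induction_on with
  | empty => simp
  | insert i s hi ih =>
    rw [Finset.forall_mem_insert] at hE
    have hdisj : Disjoint (T i) (⋃ k ∈ s, T k) := by
      rw [Set.disjoint_iUnion₂_right]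
      exact fun k hk => hT (ne_of_mem_of_not_mem hk hi).symm
    have hind := indep_iSup_of_disjoint (fun p => (hmeas p).comap_le) hf hdisj
    have hrest : MeasurableSet[⨆ p ∈ ⋃ k ∈ s, T k, MeasurableSpace.comap (f p) inferInstance]
        (⋂ k ∈ s, E k) := by
      refine Finset.measurableSet_biInter _ fun k hk => MeasurableSpace.le_def.1 ?_ _ (hE.2 k hk)
      exact biSup_mono fun p hp => Set.mem_biUnion hk hp
    rw [Finset.set_biInter_insert, Finset.prod_insert hi, ← ih hE.2]
    exact (Indep_iff _ _ _).1 hind _ _ hE.1 hrest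

lemma measureReal_exists_le_card_mul {ι κ : Type*} [Fintype κ] {E : ι → Set Ω} {f : ι → κ}
    (hf : E.FactorsThrough f) {p : ℝ} (hp : 0 ≤ p) (hE : ∀ x, Pr.real (E x) ≤ p) :
    Pr.real {ω | ∃ x, ω ∈ E x} ≤ Fintype.card κ * p := by
  set E' : κ → Set Ω := Function.extend f E fun _ => ∅ with hE'
  have hE'p : ∀ k, Pr.real (E' k) ≤ p := fun k => by
    by_cases hk : ∃ x, f x = k
    · obtain ⟨x, rfl⟩ := hk
      rw [hE', hf.extend_apply]
      exact hE x
    · rwa [hE', Function.extend_apply' _ _ _ hk, measureReal_empty]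
  calc Pr.real {ω | ∃ x, ω ∈ E x} ≤ Pr.real (⋃ k, E' k) := by
        refine measureReal_mono ?_
        rintro ω ⟨x, hx⟩
        rw [← hf.extend_apply (fun _ => ∅)] at hx
        exact Set.mem_iUnion_of_mem (f x) hx
    _ ≤ ∑ k, Pr.real (E' k) := measureReal_iUnion_fintype_le _
    _ ≤ ∑ _k : κ, p := Finset.sum_le_sum fun k _ => hE'p k
    _ = Fintype.card κ * p := by rw [Finset.sum_const, Finset.card_univ, nsmul_eq_mul]

end Independence

section Crossing

/-- If the law of the increment `V i` is at most `c i • expWeight (b i)` for every `i`, then, as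
long as the earlier partial sums `S i` are at most `t i`, the law of the partial sum `S l` is at
most `crossingConst c b t l • expWeight (b l)`. -/
def crossingConst (c b t : ℕ → ℝ) (l : ℕ) : ℝ :=
  (∏ i ∈ Finset.Icc 1 l, c i) *
    ∏ i ∈ Finset.Ico 1 l, Real.exp ((b (i + 1) - b i) * t i) / (b (i + 1) - b i)

variable {c b : ℕ → ℝ} {j l : ℕ}

lemma crossingConst_one (c b t : ℕ → ℝ) : crossingConst c b t 1 = c 1 := by
  simp [crossingConst]

lemma crossingConst_succ (c b t : ℕ → ℝ) (hl : 1 ≤ l) :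
    crossingConst c b t (l + 1) = crossingConst c b t l * c (l + 1) *
      (Real.exp ((b (l + 1) - b l) * t l) / (b (l + 1) - b l)) := by
  rw [crossingConst, crossingConst, Finset.prod_Icc_succ_top (by omega),
    Finset.prod_Ico_succ_top hl]
  ring

lemma crossingConst_div (c b t w : ℕ → ℝ) (l : ℕ) :
    crossingConst (fun i => c i / w i) b t l =
      crossingConst c b t l / ∏ i ∈ Finset.Icc 1 l, w i := by
  rw [crossingConst, crossingConst, Finset.prod_div_distrib, div_mul_eq_mul_div]

lemma crossingConst_nonneg (hc : ∀ i ∈ Finset.Icc 1 l, 0 ≤ c i)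
    (hb : ∀ i ∈ Finset.Ico 1 l, b i < b (i + 1)) (t : ℕ → ℝ) : 0 ≤ crossingConst c b t l :=
  mul_nonneg (Finset.prod_nonneg hc) (Finset.prod_nonneg fun i hi =>
    div_nonneg (Real.exp_pos _).le (sub_nonneg.2 (hb i hi).le))

lemma crossingConst_const (c b : ℕ → ℝ) (hl : 1 ≤ l) (T : ℝ) :
    crossingConst c b (fun _ => T) l = crossingConst c b 0 l * Real.exp ((b l - b 1) * T) := by
  induction l, hl using Nat.le_induction with
  | base => simp [crossingConst_one]
  | succ l hl ih =>
    rw [crossingConst_succ _ _ _ hl, crossingConst_succ _ _ _ hl, ih,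
      show (b (l + 1) - b 1) * T = (b l - b 1) * T + (b (l + 1) - b l) * T by ring, Real.exp_add]
    simp only [Pi.zero_apply, mul_zero, Real.exp_zero]
    ring

lemma crossingConst_update (c b t : ℕ → ℝ) (hl : l ∈ Finset.Ico 1 j) (s : ℝ) :
    crossingConst c b (Function.update t l s) j =
      crossingConst c b t j * Real.exp ((b (l + 1) - b l) * (s - t l)) := by
  have hcongr : ∏ i ∈ (Finset.Ico 1 j).erase l,
      Real.exp ((b (i + 1) - b i) * Function.update t l s i) / (b (i + 1) - b i) =
      ∏ i ∈ (Finset.Ico 1 j).erase l, Real.exp ((b (i + 1) - b i) * t i) / (b (i + 1) - b i) :=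
    Finset.prod_congr rfl fun i hi => by
      rw [Function.update_of_ne (Finset.ne_of_mem_erase hi)]
  rw [crossingConst, crossingConst, ← Finset.mul_prod_erase _ _ hl, hcongr,
    ← Finset.mul_prod_erase (Finset.Ico 1 j) _ hl, Function.update_self, mul_sub, Real.exp_sub]
  field_simp

lemma tendsto_crossingConst_const (hb : 0 < b 1) (hl : 1 ≤ l) :
    Tendsto (fun T => crossingConst c b (fun _ => T) l * (Real.exp (-b l * T) / b l)) atTop
      (nhds 0) := by
  have hexp : Tendsto (fun T => Real.exp (-b 1 * T)) atTop (nhds 0) :=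
    Real.tendsto_exp_atBot.comp (tendsto_id.const_mul_atTop_of_neg (neg_lt_zero.2 hb))
  refine (mul_zero (crossingConst c b 0 l / b l) ▸ hexp.const_mul _).congr fun T => ?_
  rw [crossingConst_const c b hl,
    show -b 1 * T = (b l - b 1) * T + -b l * T by ring, Real.exp_add]
  ring

lemma tendsto_crossingConst_update (t : ℕ → ℝ) (hl : l ∈ Finset.Ico 1 j) (hb : b l < b (l + 1)) :
    Tendsto (fun L => crossingConst c b (Function.update t l (-L)) j) atTop (nhds 0) := by
  have hexp : Tendsto (fun L => Real.exp ((b (l + 1) - b l) * (-L - t l))) atTop (nhds 0) :=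
    Real.tendsto_exp_atBot.comp <| (tendsto_atBot_add_const_right _ (-t l)
      tendsto_neg_atTop_atBot).const_mul_atBot (sub_pos.2 hb)
  refine (mul_zero (crossingConst c b t j) ▸ hexp.const_mul _).congr fun L => ?_
  rw [crossingConst_update c b t hl]

lemma forall_le_or_exists_first_ge (x : ℕ → ℝ) (T : ℝ) (j : ℕ) :
    (∀ i ∈ Finset.Icc 1 j, x i ≤ T) ∨
      ∃ l ∈ Finset.Icc 1 j, (∀ i ∈ Finset.Ico 1 l, x i ≤ T) ∧ T ≤ x l := by
  induction j with
  | zero => simp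
  | succ j ih =>
    rcases ih with hle | ⟨l, hl, hfirst⟩
    · rcases le_total (x (j + 1)) T with h | h
      · left
        intro i hi
        rcases Nat.le_succ_iff.1 (Finset.mem_Icc.1 hi).2 with hij | rfl
        exacts [hle i (Finset.mem_Icc.2 ⟨(Finset.mem_Icc.1 hi).1, hij⟩), h]
      · exact .inr ⟨j + 1, by simp, fun i hi => hle i (by simp_all), h⟩
    · exact .inr ⟨l, Finset.Icc_subset_Icc_right j.le_succ hl, hfirst⟩

lemma forall_abs_sub_le_or_exists_crossing {x : ℕ → ℝ} (hx : x 0 = 0) {R T L : ℝ} (hT : 0 ≤ T)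
    (hL : 0 ≤ L) (hxj : x j ∈ Set.Icc (-R) R) :
    (∀ i ∈ Finset.Icc 1 j, |x i - x (i - 1)| ≤ 2 * (R + T + L)) ∨
      (∃ l ∈ Finset.Icc 1 j, (∀ i ∈ Finset.Ico 1 l, x i ≤ T) ∧ T ≤ x l) ∨
      ∃ l ∈ Finset.Ico 1 j, ∀ i ∈ Finset.Ico 1 j, x i ≤ Function.update (fun _ => T) l (-L) i := by
  obtain hup | hcross := forall_le_or_exists_first_ge x T j
  · by_cases hdown : ∃ l ∈ Finset.Ico 1 j, x l ≤ -L
    · obtain ⟨l, hl, hlL⟩ := hdown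
      refine .inr (.inr ⟨l, hl, fun i hi => ?_⟩)
      obtain rfl | hil := eq_or_ne i l
      · rwa [Function.update_self]
      · rw [Function.update_of_ne hil]
        exact hup i (Finset.Ico_subset_Icc_self hi)
    · push Not at hdown
      have hR : 0 ≤ R := by linarith [hxj.1, hxj.2]
      have hbound : ∀ i ≤ j, |x i| ≤ R + T + L := fun i hi => by
        rcases Nat.eq_zero_or_pos i with rfl | hi0
        · rw [hx, abs_zero]
          positivity
        rcases hi.eq_or_lt with rfl | hij
        · exact abs_le.2 ⟨by linarith [hxj.1], by linarith [hxj.2]⟩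
        · exact abs_le.2 ⟨by linarith [hdown i (Finset.mem_Ico.2 ⟨hi0, hij⟩)],
            by linarith [hup i (Finset.mem_Icc.2 ⟨hi0, hi⟩)]⟩
      refine .inl fun i hi => ?_
      have hij := (Finset.mem_Icc.1 hi).2
      linarith [abs_sub (x i) (x (i - 1)), hbound i hij, hbound (i - 1) (by omega)]
  · exact .inr (.inl hcross)

section PartialSums

variable {Ω : Type*} [m : MeasurableSpace Ω] {Pr : Measure Ω} [IsProbabilityMeasure Pr]
  {𝓕 : Filtration ℕ m} {V : ℕ → Ω → ℝ}

lemma measurable_partialSum (hV : ∀ l, Measurable[𝓕 l] (V l)) {i l : ℕ} (hil : i ≤ l) :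
    Measurable[𝓕 l] fun ω => ∑ q ∈ Finset.Icc 1 i, V q ω :=
  Finset.measurable_fun_sum _ fun q hq =>
    (hV q).mono (𝓕.mono ((Finset.mem_Icc.1 hq).2.trans hil)) le_rfl

lemma measurableSet_partialSums_le (hV : ∀ l, Measurable[𝓕 l] (V l)) (t : ℕ → ℝ) (l : ℕ) :
    MeasurableSet[𝓕 l] {ω | ∀ i ∈ Finset.Ico 1 l, ∑ q ∈ Finset.Icc 1 i, V q ω ≤ t i} := by
  have hset : {ω | ∀ i ∈ Finset.Ico 1 l, ∑ q ∈ Finset.Icc 1 i, V q ω ≤ t i} =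
      ⋂ i ∈ Finset.Ico 1 l, (fun ω => ∑ q ∈ Finset.Icc 1 i, V q ω) ⁻¹' Set.Iic (t i) := by
    ext ω
    simp
  rw [hset]
  exact Finset.measurableSet_biInter _ fun i hi =>
    measurable_partialSum hV (Finset.mem_Ico.1 hi).2.le measurableSet_Iic

variable (hV : ∀ l, Measurable[𝓕 l] (V l))
  (hind : ∀ l, Indep (𝓕 l) (MeasurableSpace.comap (V (l + 1)) inferInstance) Pr)
  (hc : ∀ i ∈ Finset.Icc 1 l, 0 ≤ c i) (hb : ∀ i ∈ Finset.Ico 1 l, b i < b (i + 1))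
  (hlaw : ∀ i ∈ Finset.Icc 1 l, Pr.map (V i) ≤ ENNReal.ofReal (c i) • expWeight (b i))

include hV hind hc hb hlaw

lemma map_restrict_partialSum_le (hl : 1 ≤ l) (t : ℕ → ℝ) :
    (Pr.restrict {ω | ∀ i ∈ Finset.Ico 1 l, ∑ q ∈ Finset.Icc 1 i, V q ω ≤ t i}).map
        (fun ω => ∑ q ∈ Finset.Icc 1 l, V q ω) ≤
      ENNReal.ofReal (crossingConst c b t l) • expWeight (b l) := by
  induction l, hl using Nat.le_induction with
  | base => simpa [crossingConst_one] using hlaw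
  | succ l hl ih =>
    have hIcc : Finset.Icc 1 l ⊆ Finset.Icc 1 (l + 1) := Finset.Icc_subset_Icc_right l.le_succ
    have hIco : Finset.Ico 1 l ⊆ Finset.Ico 1 (l + 1) := Finset.Ico_subset_Ico_right l.le_succ
    specialize ih (fun i hi => hc i (hIcc hi)) (fun i hi => hb i (hIco hi))
      (fun i hi => hlaw i (hIcc hi))
    set S : Ω → ℝ := fun ω => ∑ q ∈ Finset.Icc 1 l, V q ω with hS
    set G : Set Ω := {ω | ∀ i ∈ Finset.Ico 1 l, ∑ q ∈ Finset.Icc 1 i, V q ω ≤ t i} with hG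
    have hSm : Measurable[𝓕 l] S := measurable_partialSum hV le_rfl
    have hGm : MeasurableSet[𝓕 l] G := measurableSet_partialSums_le hV t l
    have hnext : {ω | ∀ i ∈ Finset.Ico 1 (l + 1), ∑ q ∈ Finset.Icc 1 i, V q ω ≤ t i} =
        S ⁻¹' Set.Iic (t l) ∩ G := by
      ext ω
      simp [hS, hG, ← Finset.insert_Ico_right_eq_Ico_add_one hl]
    have hsum : (fun ω => ∑ q ∈ Finset.Icc 1 (l + 1), V q ω) = fun ω => S ω + V (l + 1) ω :=
      funext fun ω => Finset.sum_Icc_succ_top (by omega) _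
    have hSm' := hSm.mono (𝓕.le l) le_rfl
    rw [hnext, hsum, map_restrict_add_eq_conv_of_indep (𝓕.le l)
      ((hSm measurableSet_Iic).inter hGm) hSm ((hV (l + 1)).mono (𝓕.le _) le_rfl) (hind l),
      ← Measure.restrict_restrict (hSm' measurableSet_Iic),
      ← Measure.restrict_map hSm' measurableSet_Iic, crossingConst_succ _ _ _ hl]
    exact conv_restrict_Iic_le_expWeight
      (crossingConst_nonneg (fun i hi => hc i (hIcc hi)) (fun i hi => hb i (hIco hi)) t)
      (hb l (by simp; omega)) ih (hlaw (l + 1) (by simp)) (t l)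

lemma measureReal_partialSum_mem_le (hl : 1 ≤ l) (t : ℕ → ℝ) {E : Set ℝ} (hE : MeasurableSet E)
    {x : ℝ} (hx : 0 ≤ x) (hEx : expWeight (b l) E ≤ ENNReal.ofReal x) :
    Pr.real {ω | (∀ i ∈ Finset.Ico 1 l, ∑ q ∈ Finset.Icc 1 i, V q ω ≤ t i) ∧
      ∑ q ∈ Finset.Icc 1 l, V q ω ∈ E} ≤ crossingConst c b t l * x := by
  have hSm := (measurable_partialSum hV (le_refl l)).mono (𝓕.le l) le_rfl
  have hle := measureReal_le_mul_of_le_expWeight (crossingConst_nonneg hc hb t)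
    (map_restrict_partialSum_le hV hind hc hb hlaw hl t) hx hEx
  rwa [map_measureReal_apply hSm hE, measureReal_restrict_apply (hSm hE), Set.inter_comm] at hle

end PartialSums

end Crossing

section SharedSummand

variable {Ω : Type*} [MeasurableSpace Ω] {Pr : Measure Ω} [IsProbabilityMeasure Pr]
  {Y Z Z' : Ω → ℝ}

lemma measure_le_and_add_mem_eq_lintegral (hY : Measurable Y) (hZ : Measurable Z)
    (hZ' : Measurable Z') (hYZ : IndepFun Y (fun ω => (Z ω, Z' ω)) Pr) (hZZ' : IndepFun Z Z' Pr)
    {E : Set ℝ} (hE : MeasurableSet E) (t : ℝ) :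
    Pr {ω | Y ω ≤ t ∧ Y ω + Z ω ∈ E ∧ Y ω + Z' ω ∈ E} =
      ∫⁻ y in Set.Iic t, Pr.map Z ((y + ·) ⁻¹' E) * Pr.map Z' ((y + ·) ⁻¹' E) ∂Pr.map Y := by
  have := Measure.isProbabilityMeasure_map hZ.aemeasurable (μ := Pr)
  have := Measure.isProbabilityMeasure_map hZ'.aemeasurable (μ := Pr)
  have hlaw := (indepFun_iff_map_prod_eq_prod_map_map hY.aemeasurable
    (hZ.prodMk hZ').aemeasurable).1 hYZ
  rw [(indepFun_iff_map_prod_eq_prod_map_map hZ.aemeasurable hZ'.aemeasurable).1 hZZ'] at hlaw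
  set B : Set (ℝ × ℝ × ℝ) := {x | x.1 ≤ t ∧ x.1 + x.2.1 ∈ E ∧ x.1 + x.2.2 ∈ E} with hB
  have hBm : MeasurableSet B :=
    (measurable_fst measurableSet_Iic).inter
      ((measurableSet_preimage (by fun_prop) hE).inter (measurableSet_preimage (by fun_prop) hE))
  have hsection : ∀ y, ((Pr.map Z).prod (Pr.map Z')) (Prod.mk y ⁻¹' B) =
      (Set.Iic t).indicator
        (fun y => Pr.map Z ((y + ·) ⁻¹' E) * Pr.map Z' ((y + ·) ⁻¹' E)) y := fun y => by
    by_cases hy : y ≤ t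
    · rw [Set.indicator_of_mem (Set.mem_Iic.2 hy), ← Measure.prod_prod]
      congr 1
      ext x
      simp [hB, hy]
    · simp [hB, hy]
  calc Pr {ω | Y ω ≤ t ∧ Y ω + Z ω ∈ E ∧ Y ω + Z' ω ∈ E}
      = Pr.map (fun ω => (Y ω, Z ω, Z' ω)) B :=
        (Measure.map_apply (hY.prodMk (hZ.prodMk hZ')) hBm).symm
    _ = _ := by
        rw [hlaw, Measure.prod_apply hBm, lintegral_congr hsection,
          lintegral_indicator measurableSet_Iic]

lemma measure_preimage_const_add_Icc_le {μ : Measure ℝ} {c b : ℝ} (hb : 0 ≤ b)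
    (hc : 0 ≤ c) (hμ : μ ≤ ENNReal.ofReal c • expWeight b) (p q y : ℝ) :
    μ ((y + ·) ⁻¹' Set.Icc p q) ≤
      ENNReal.ofReal (c * (Real.exp (-b * p) * (q - p))) * ENNReal.ofReal (Real.exp (b * y)) := by
  refine (hμ _).trans ?_
  rw [Measure.smul_apply, smul_eq_mul, expWeight_preimage_const_add _ _ measurableSet_Icc,
    ENNReal.ofReal_mul hc, mul_assoc, mul_comm (ENNReal.ofReal (Real.exp (b * y)))]
  gcongr
  exact expWeight_Icc_le hb p q

lemma measureReal_shared_le (hY : Measurable Y) (hZ : Measurable Z) (hZ' : Measurable Z')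
    (hYZ : IndepFun Y (fun ω => (Z ω, Z' ω)) Pr) (hZZ' : IndepFun Z Z' Pr) {c c' b : ℝ}
    (hb : 0 < b) (hc : 0 ≤ c) (hc' : 0 ≤ c') (lawY : Pr.map Y ≤ ENNReal.ofReal c • expWeight b)
    (lawZ : Pr.map Z ≤ ENNReal.ofReal c' • expWeight b)
    (lawZ' : Pr.map Z' ≤ ENNReal.ofReal c' • expWeight b) {p q : ℝ} (hpq : p ≤ q) (t : ℝ) :
    Pr.real {ω | Y ω ≤ t ∧ Y ω + Z ω ∈ Set.Icc p q ∧ Y ω + Z' ω ∈ Set.Icc p q} ≤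
      c * (c' * (Real.exp (-b * p) * (q - p))) ^ 2 * (Real.exp (b * t) / b) := by
  set κ := c' * (Real.exp (-b * p) * (q - p)) with hκ
  have hκ0 : 0 ≤ κ :=
    mul_nonneg hc' (mul_nonneg (Real.exp_pos _).le (sub_nonneg.2 hpq))
  have hsection : ∀ y, Pr.map Z ((y + ·) ⁻¹' Set.Icc p q) *
      Pr.map Z' ((y + ·) ⁻¹' Set.Icc p q) ≤
      ENNReal.ofReal (κ ^ 2) * ENNReal.ofReal (Real.exp (2 * b * y)) := fun y => by
    refine (mul_le_mul' (measure_preimage_const_add_Icc_le hb.le hc' lawZ p q y)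
      (measure_preimage_const_add_Icc_le hb.le hc' lawZ' p q y)).trans_eq ?_
    rw [mul_mul_mul_comm, ← hκ, ← ENNReal.ofReal_mul hκ0,
      ← ENNReal.ofReal_mul (Real.exp_pos _).le, ← Real.exp_add, ← sq, ← two_mul, mul_assoc]
  refine ENNReal.toReal_le_of_le_ofReal (by positivity) ?_
  calc Pr {ω | Y ω ≤ t ∧ Y ω + Z ω ∈ Set.Icc p q ∧ Y ω + Z' ω ∈ Set.Icc p q}
      = _ := measure_le_and_add_mem_eq_lintegral hY hZ hZ' hYZ hZZ' measurableSet_Icc t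
    _ ≤ ∫⁻ y in Set.Iic t, ENNReal.ofReal (κ ^ 2) * ENNReal.ofReal (Real.exp (2 * b * y))
          ∂(ENNReal.ofReal c • expWeight b) :=
        lintegral_mono' (Measure.restrict_mono le_rfl lawY) hsection
    _ = ENNReal.ofReal (c * κ ^ 2 * (Real.exp (b * t) / b)) := by
        rw [Measure.restrict_smul, lintegral_smul_measure, lintegral_const_mul _ (by fun_prop),
          setLIntegral_exp_expWeight (by linarith : b < 2 * b), smul_eq_mul,
          ← ENNReal.ofReal_mul (by positivity), ← ENNReal.ofReal_mul hc]
        ring_nf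

end SharedSummand

namespace GREM

variable {n : ℕ} (M : GREM n)

section NominalCard

/-- The nominal number `2 ^ (γ(A) N)` of configurations in `Σ_{N,A}`, without integer parts. -/
def nominalCard (N : ℕ) (A : Finset (Fin n)) : ℝ := (2 : ℝ) ^ (M.gam A * N)

variable (N : ℕ)

lemma nominalCard_pos (A : Finset (Fin n)) : 0 < M.nominalCard N A :=
  Real.rpow_pos_of_pos two_pos _

lemma nominalCard_eq_exp (A : Finset (Fin n)) :
    M.nominalCard N A = Real.exp (Real.log 2 * M.gam A * N) := by
  rw [nominalCard, Real.rpow_def_of_pos two_pos, mul_assoc]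

lemma nominalCard_empty : M.nominalCard N ∅ = 1 := by
  simp [nominalCard, gam]

lemma nominalCard_union {A B : Finset (Fin n)} (h : Disjoint A B) :
    M.nominalCard N (A ∪ B) = M.nominalCard N A * M.nominalCard N B := by
  rw [nominalCard, nominalCard, nominalCard, M.gam_union h, add_mul, Real.rpow_add two_pos]

lemma nominalCard_chain_succ (l : ℕ) :
    M.nominalCard N (M.chain (l + 1)) =
      M.nominalCard N (M.chain l) * M.nominalCard N (M.block (l + 1)) := by
  rw [← M.chain_sub_one_union_block (l + 1), block, M.nominalCard_union N Finset.disjoint_sdiff,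
    Nat.add_sub_cancel]

lemma prod_nominalCard_block {r l : ℕ} (h : r ≤ l) :
    M.nominalCard N (M.chain r) * ∏ i ∈ Finset.Icc (r + 1) l, M.nominalCard N (M.block i) =
      M.nominalCard N (M.chain l) := by
  induction l, h using Nat.le_induction with
  | base => simp
  | succ l h ih =>
    rw [Finset.prod_Icc_succ_top (by omega), ← mul_assoc, ih, ← M.nominalCard_chain_succ]

lemma prod_nominalCard_block_Icc_one (l : ℕ) :
    ∏ i ∈ Finset.Icc 1 l, M.nominalCard N (M.block i) = M.nominalCard N (M.chain l) := by
  rw [← M.prod_nominalCard_block N (Nat.zero_le l), chain, nominalCard_empty, one_mul]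

lemma card_conf_le_nominalCard (A : Finset (Fin n)) :
    (Fintype.card (M.Conf N A) : ℝ) ≤ M.nominalCard N A := by
  rw [Fintype.card_pi, Finset.univ_eq_attach,
    Finset.prod_attach A fun i => Fintype.card (Fin (M.size N i)),
    nominalCard, gam, Finset.sum_mul, Real.rpow_sum_of_pos two_pos, Nat.cast_prod]
  simp only [Fintype.card_fin]
  exact Finset.prod_le_prod (fun i _ => Nat.cast_nonneg _) fun i _ => Nat.floor_le (by positivity)

end NominalCard

section Level

variable {M}

lemma mem_level {l : ℕ} {J : Finset (Fin n)} :
    J ∈ M.level l ↔ (J ⊆ M.chain l ∧ 0 < M.a J) ∧ ¬ J ⊆ M.chain (l - 1) := by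
  rw [level, Finset.mem_sdiff, mem_P, mem_P]
  tauto

lemma level_subset_P (l : ℕ) : M.level l ⊆ M.P Finset.univ :=
  Finset.sdiff_subset.trans (M.P_mono (Finset.subset_univ _))

lemma pairwise_disjoint_level : Pairwise (Function.onFun Disjoint M.level) := by
  refine (pairwise_disjoint_on _).2 fun i j hij => Finset.disjoint_left.2 fun J hi hj => ?_
  exact (mem_level.1 hj).2 ((mem_level.1 hi).1.1.trans (M.chain_mono (by omega)))

end Level

/-- The configurations `Σ_{N,I}`. Configurations on a subset `A` of `I` are handled as restrictions
of these, so that the energies of all levels have the same argument. -/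
abbrev FullConf (N : ℕ) : Type := (i : Fin n) → Fin (M.size N i)

/-- The pairs `(J, τ)` that index the disorder variables. -/
abbrev DisorderIndex (N : ℕ) : Type := Σ J : {J // J ∈ M.P Finset.univ}, M.Conf N J.1

variable {M} {N : ℕ} {Ω : Type*}

section Energy

/-- The sum of the variables `X J σ_J` over `J ∈ L`. -/
def energyOn (X : (J : Finset (Fin n)) → M.Conf N J → Ω → ℝ) (L : Finset (Finset (Fin n)))
    (σ : M.FullConf N) (ω : Ω) : ℝ :=
  ∑ J ∈ L, X J (J.restrict σ) ω

/-- The indices of the disorder variables that occur in `energyOn X L σ`. -/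
def energyIndices (L : Finset (Finset (Fin n))) (σ : M.FullConf N) : Set (M.DisorderIndex N) :=
  {p | p.1.1 ∈ L ∧ p.2 = p.1.1.restrict σ}

/-- The σ-algebra generated by the disorder variables with index in `T`. -/
abbrev disorderSigma (X : (J : Finset (Fin n)) → M.Conf N J → Ω → ℝ)
    (T : Set (M.DisorderIndex N)) : MeasurableSpace Ω :=
  ⨆ p ∈ T, MeasurableSpace.comap (X p.1.1 p.2) inferInstance

variable {X : (J : Finset (Fin n)) → M.Conf N J → Ω → ℝ} {L L' : Finset (Finset (Fin n))}

lemma measurable_energyOn_disorderSigma (hL : L ⊆ M.P Finset.univ) {σ : M.FullConf N}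
    {T : Set (M.DisorderIndex N)} (hT : energyIndices L σ ⊆ T) :
    Measurable[disorderSigma X T] (energyOn X L σ) := by
  refine @Finset.measurable_fun_sum _ _ _ _ _ _ (disorderSigma X T) _ L fun J hJ => ?_
  have hmem : (⟨⟨J, hL hJ⟩, J.restrict σ⟩ : M.DisorderIndex N) ∈ T := hT ⟨hJ, rfl⟩
  exact (comap_measurable (X J (J.restrict σ))).mono
    (le_biSup (fun p : M.DisorderIndex N => MeasurableSpace.comap (X p.1.1 p.2) inferInstance) hmem)
    le_rfl

lemma energyOn_insert {J : Finset (Fin n)} (hJ : J ∉ L) (σ : M.FullConf N) :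
    energyOn X (insert J L) σ = X J (J.restrict σ) + energyOn X L σ :=
  funext fun _ => Finset.sum_insert hJ

lemma energyOn_union (h : Disjoint L L') (σ : M.FullConf N) (ω : Ω) :
    energyOn X (L ∪ L') σ ω = energyOn X L σ ω + energyOn X L' σ ω :=
  Finset.sum_union h

lemma energyOn_congr {σ τ : M.FullConf N} (h : ∀ J ∈ L, ∀ i ∈ J, σ i = τ i) :
    energyOn X L σ = energyOn X L τ := by
  funext ω
  refine Finset.sum_congr rfl fun J hJ => ?_
  rw [show J.restrict σ = J.restrict τ from funext fun i => h J hJ i i.2]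

lemma disjoint_energyIndices {σ τ : M.FullConf N}
    (h : ∀ J ∈ L, J ∈ L' → ∃ i ∈ J, σ i ≠ τ i) :
    Disjoint (energyIndices L σ) (energyIndices L' τ) := by
  rw [Set.disjoint_left]
  rintro ⟨J, c⟩ ⟨hL, hσ⟩ ⟨hL', hτ⟩
  obtain ⟨i, hi, hne⟩ := h J hL hL'
  exact hne (congrFun (hσ.symm.trans hτ) ⟨i, hi⟩)

lemma disjoint_energyIndices_of_disjoint (h : Disjoint L L') (σ τ : M.FullConf N) :
    Disjoint (energyIndices L σ) (energyIndices L' τ) :=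
  disjoint_energyIndices fun _ hJ hJ' => (Finset.disjoint_left.1 h hJ hJ').elim

variable [m : MeasurableSpace Ω] {Pr : Measure Ω} (hX : M.IsDisorder Pr X)
  (hm : ∀ J τ, Measurable (X J τ))

include hm

lemma disorderSigma_le (T : Set (M.DisorderIndex N)) : disorderSigma X T ≤ m :=
  iSup₂_le fun p _ => (hm p.1.1 p.2).comap_le

lemma measurable_energyOn (L : Finset (Finset (Fin n))) (σ : M.FullConf N) :
    Measurable (energyOn X L σ) :=
  Finset.measurable_fun_sum _ fun J _ => hm J _

include hX

lemma indep_disorderSigma {S T : Set (M.DisorderIndex N)} (h : Disjoint S T) :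
    Indep (disorderSigma X S) (disorderSigma X T) Pr :=
  indep_iSup_of_disjoint (fun p : M.DisorderIndex N => (hm p.1.1 p.2).comap_le) hX.indep h

lemma indepFun_of_disjoint {α β : Type*} [MeasurableSpace α] [MeasurableSpace β]
    {S T : Set (M.DisorderIndex N)} (h : Disjoint S T) {U : Ω → α} {W : Ω → β}
    (hU : Measurable[disorderSigma X S] U) (hW : Measurable[disorderSigma X T] W) :
    IndepFun U W Pr :=
  (IndepFun_iff_Indep _ _ _).2 (indep_of_indep_of_le_left
    (indep_of_indep_of_le_right (indep_disorderSigma hX hm h) hW.comap_le) hU.comap_le)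

variable [IsProbabilityMeasure Pr]

lemma map_energyOn (hL : L ⊆ M.P Finset.univ) (σ : M.FullConf N) :
    Pr.map (energyOn X L σ) = gaussianReal 0 ((∑ J ∈ L, M.a J) * N).toNNReal := by
  induction L using Finset.induction_on with
  | empty =>
    rw [show energyOn X ∅ σ = fun _ => (0 : ℝ) from funext fun _ => Finset.sum_empty]
    simp
  | insert J L hJ ih =>
    rw [Finset.insert_subset_iff] at hL
    have hind : IndepFun (energyOn X {J} σ) (energyOn X L σ) Pr :=
      indepFun_of_disjoint hX hm
        (disjoint_energyIndices_of_disjoint (Finset.disjoint_singleton_left.2 hJ) σ σ)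
        (measurable_energyOn_disorderSigma (Finset.singleton_subset_iff.2 hL.1) le_rfl)
        (measurable_energyOn_disorderSigma hL.2 le_rfl)
    rw [show energyOn X {J} σ = X J (J.restrict σ) from funext fun _ => Finset.sum_singleton _ _]
      at hind
    have hsum : 0 ≤ ∑ J ∈ L, M.a J := Finset.sum_nonneg fun J _ => M.a_nonneg J
    have hJ0 := M.a_nonneg J
    rw [energyOn_insert hJ, gaussianReal_add_gaussianReal_of_indepFun hind
      (hX.hasLaw J hL.1 _).map_eq (ih hL.2), Finset.sum_insert hJ, add_mul,
      Real.toNNReal_add (by positivity) (by positivity), add_zero]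

lemma map_energyOn_le (hL : L ⊆ M.P Finset.univ) (σ : M.FullConf N) (b : ℝ)
    (hpos : 0 < (∑ J ∈ L, M.a J) * N) :
    Pr.map (energyOn X L σ) ≤
      ENNReal.ofReal (gaussConst b ((∑ J ∈ L, M.a J) * N)) • expWeight b := by
  rw [map_energyOn hX hm hL]
  exact gaussianReal_le_expWeight b hpos

end Energy

section LevelEnergy

/-- The centered energy of the `l`-th level. -/
def levelEnergy (X : (J : Finset (Fin n)) → M.Conf N J → Ω → ℝ) (l : ℕ) (σ : M.FullConf N)
    (ω : Ω) : ℝ :=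
  energyOn X (M.level l) σ ω - M.aN N l

/-- The partial energy `X̂_{σ(1),…,σ(l)}`, as a function on `Σ_{N,I}`. -/
def partialEnergy (X : (J : Finset (Fin n)) → M.Conf N J → Ω → ℝ) (l : ℕ) (σ : M.FullConf N)
    (ω : Ω) : ℝ :=
  ∑ i ∈ Finset.Icc 1 l, levelEnergy X i σ ω

/-- The σ-algebra of the disorder variables of the `l`-th level. -/
abbrev levelSigma (X : (J : Finset (Fin n)) → M.Conf N J → Ω → ℝ) (l : ℕ) : MeasurableSpace Ω :=
  disorderSigma X {p | p.1.1 ∈ M.level l}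

/-- The filtration whose `l`-th σ-algebra is that of the disorder variables of the levels
`1, …, l`. -/
def levelFiltration {X : (J : Finset (Fin n)) → M.Conf N J → Ω → ℝ} [m : MeasurableSpace Ω]
    (hm : ∀ J τ, Measurable (X J τ)) : Filtration ℕ m where
  seq l := disorderSigma X {p | p.1.1 ∈ M.P (M.chain l)}
  mono' _ _ h := biSup_mono fun _ hp => M.P_mono (M.chain_mono h) hp
  le' _ := disorderSigma_le hm _

variable {X : (J : Finset (Fin n)) → M.Conf N J → Ω → ℝ} {l : ℕ} {σ τ : M.FullConf N}

lemma levelEnergy_congr (h : ∀ i ∈ M.chain l, σ i = τ i) :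
    levelEnergy X l σ = levelEnergy X l τ := by
  unfold levelEnergy
  rw [energyOn_congr fun J hJ i hi => h i (M.subset_of_mem_level hJ hi)]

lemma partialEnergy_congr (h : ∀ i ∈ M.chain l, σ i = τ i) :
    partialEnergy X l σ = partialEnergy X l τ :=
  funext fun _ => Finset.sum_congr rfl fun i hi => by
    rw [levelEnergy_congr fun s hs => h s (M.chain_mono (Finset.mem_Icc.1 hi).2 hs)]

lemma measurable_levelEnergy_levelSigma (l : ℕ) (σ : M.FullConf N) :
    Measurable[levelSigma X l] (levelEnergy X l σ) :=
  Measurable.sub_const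
    (measurable_energyOn_disorderSigma (level_subset_P l) fun _ hp => hp.1) _

variable [m : MeasurableSpace Ω] (hm : ∀ J τ, Measurable (X J τ))

lemma measurable_levelEnergy_levelFiltration (l : ℕ) (σ : M.FullConf N) :
    Measurable[levelFiltration hm l] (levelEnergy X l σ) :=
  (measurable_levelEnergy_levelSigma l σ).mono
    (biSup_mono fun _ hp => (Finset.mem_sdiff.1 hp).1) le_rfl

include hm in
lemma measurable_levelEnergy (l : ℕ) (σ : M.FullConf N) : Measurable (levelEnergy X l σ) :=
  (measurable_energyOn hm _ σ).sub_const _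

variable {Pr : Measure Ω} (hX : M.IsDisorder Pr X)

include hX

lemma indep_levelFiltration_levelEnergy (l : ℕ) (σ : M.FullConf N) :
    Indep (levelFiltration hm l)
      (MeasurableSpace.comap (levelEnergy X (l + 1) σ) inferInstance) Pr := by
  refine indep_of_indep_of_le_right (indep_disorderSigma hX hm ?_)
    (measurable_levelEnergy_levelSigma (l + 1) σ).comap_le
  exact Set.disjoint_left.2 fun p hp hp' => (Finset.mem_sdiff.1 hp').2 hp

include hm

variable [IsProbabilityMeasure Pr]

lemma measureReal_biInter_levels (s : Finset ℕ) {E : ℕ → Set Ω}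
    (hE : ∀ i ∈ s, MeasurableSet[levelSigma X i] (E i)) :
    Pr.real (⋂ i ∈ s, E i) = ∏ i ∈ s, Pr.real (E i) := by
  have hdisj : Pairwise (Function.onFun Disjoint
      fun i => {p : M.DisorderIndex N | p.1.1 ∈ M.level i}) := fun i j hij =>
    Set.disjoint_left.2 fun _ hi hj => Finset.disjoint_left.1 (pairwise_disjoint_level hij) hi hj
  rw [measureReal_def, measure_biInter_eq_prod_of_indep hX.indep (fun p => hm p.1.1 p.2) hdisj s hE,
    ENNReal.toReal_prod]
  rfl

end LevelEnergy

section LevelLaw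

variable (M) in
/-- Up to the factor `nominalCard N (block l)⁻¹`, the constant with which `expWeight β_l` dominates
the law of a centered energy of the `l`-th level. -/
def levelConst (l : ℕ) : ℝ := (2 * Real.pi * M.beta l * M.Delta l)⁻¹

variable (M) in
/-- Up to the factor `nominalCard N (block l)⁻¹`, a bound on the probability that a centered energy
of the `l`-th level lies in `[-C, C]`. -/
def windowConst (C : ℝ) (l : ℕ) : ℝ :=
  M.levelConst l * (Real.exp (M.beta l * C) * (2 * C))

variable (hcover : ∀ i : Fin n, ∃ J ∈ M.P Finset.univ, i ∈ J) {l : ℕ} (hl : 1 ≤ l)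
  (hlK : l ≤ M.K)

include hcover hl hlK

lemma levelConst_pos : 0 < M.levelConst l := by
  have hβ := M.beta_pos hcover hl hlK
  have hΔ := M.Delta_pos hcover hl hlK
  unfold levelConst
  positivity

lemma windowConst_nonneg {C : ℝ} (hC : 0 ≤ C) : 0 ≤ M.windowConst C l := by
  have := levelConst_pos hcover hl hlK
  unfold windowConst
  positivity

lemma exp_beta_sq_mul_Delta (N : ℕ) :
    Real.exp (M.beta l ^ 2 * M.Delta l * N) = M.nominalCard N (M.block l) ^ 2 := by
  rw [M.beta_sq_mul_Delta hcover hl hlK, nominalCard_eq_exp, sq, ← Real.exp_add]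
  ring_nf

lemma gaussConst_beta_Delta (N : ℕ) :
    gaussConst (M.beta l) (M.Delta l * N) =
      M.nominalCard N (M.block l) / √(2 * Real.pi * (M.Delta l * N)) := by
  rw [gaussConst, ← mul_assoc (M.beta l ^ 2), Real.exp_half,
    exp_beta_sq_mul_Delta hcover hl hlK, Real.sqrt_sq (M.nominalCard_pos N _).le, div_eq_inv_mul]

lemma exp_neg_beta_mul_aN (hN : 0 < N) :
    Real.exp (-M.beta l * M.aN N l) =
      √N / (M.nominalCard N (M.block l) ^ 2 * (M.beta l * √(2 * Real.pi * M.Delta l))) := by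
  have hN' : (0 : ℝ) < N := Nat.cast_pos.2 hN
  have hβ := M.beta_pos hcover hl hlK
  have hΔ := M.Delta_pos hcover hl hlK
  have hexp : -M.beta l * M.aN N l = Real.log √N - (M.beta l ^ 2 * M.Delta l * N +
      Real.log (M.beta l * √(2 * Real.pi * M.Delta l))) := by
    rw [aN, Real.log_sqrt hN'.le]
    field_simp
    ring
  rw [hexp, Real.exp_sub, Real.exp_add, Real.exp_log (by positivity), Real.exp_log (by positivity),
    exp_beta_sq_mul_Delta hcover hl hlK]

variable {X : (J : Finset (Fin n)) → M.Conf N J → Ω → ℝ} [m : MeasurableSpace Ω]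
  {Pr : Measure Ω} [IsProbabilityMeasure Pr] (hX : M.IsDisorder Pr X)
  (hm : ∀ J τ, Measurable (X J τ))

include hX hm

lemma map_levelEnergy_le (hN : 0 < N) (σ : M.FullConf N) :
    Pr.map (levelEnergy X l σ) ≤
      ENNReal.ofReal (M.levelConst l / M.nominalCard N (M.block l)) • expWeight (M.beta l) := by
  have hN' : (0 : ℝ) < N := Nat.cast_pos.2 hN
  have hβ := M.beta_pos hcover hl hlK
  have hΔ := M.Delta_pos hcover hl hlK
  have hcard := M.nominalCard_pos N (M.block l)
  have hconst : gaussConst (M.beta l) (M.Delta l * N) * Real.exp (M.beta l * -M.aN N l) =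
      M.levelConst l / M.nominalCard N (M.block l) := by
    have hlevel : M.levelConst l = (M.beta l * √(2 * Real.pi * M.Delta l) ^ 2)⁻¹ := by
      rw [Real.sq_sqrt (by positivity), levelConst]
      ring
    rw [mul_neg, ← neg_mul, exp_neg_beta_mul_aN hcover hl hlK hN,
      gaussConst_beta_Delta hcover hl hlK, ← mul_assoc, Real.sqrt_mul (by positivity), hlevel]
    field_simp
  have hlaw := map_const_add_le_expWeight (gaussConst_nonneg _ _) (map_energyOn_le hX hm
    (level_subset_P l) σ (M.beta l) (M.Delta_eq_sum l ▸ mul_pos hΔ hN')) (-M.aN N l)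
  rw [← M.Delta_eq_sum, hconst,
    Measure.map_map (measurable_const_add _) (measurable_energyOn hm _ σ)] at hlaw
  convert hlaw using 2
  funext ω
  exact sub_eq_neg_add _ _

lemma measureReal_levelEnergy_mem_Icc_le (hN : 0 < N) {C : ℝ} (hC : 0 ≤ C) (σ : M.FullConf N) :
    Pr.real {ω | levelEnergy X l σ ω ∈ Set.Icc (-C) C} ≤
      M.windowConst C l / M.nominalCard N (M.block l) := by
  have hle := measureReal_Icc_le_of_le_expWeight (M.beta_pos hcover hl hlK).le
    (div_nonneg (levelConst_pos hcover hl hlK).le (M.nominalCard_pos N _).le)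
    (map_levelEnergy_le hcover hl hlK hX hm hN σ) (neg_le_self hC)
  rw [map_measureReal_apply (measurable_levelEnergy hm l σ) measurableSet_Icc] at hle
  refine hle.trans_eq ?_
  rw [windowConst, neg_mul_neg, sub_neg_eq_add, ← two_mul, div_mul_eq_mul_div]

end LevelLaw

end GREM

namespace GREM

variable {n : ℕ} {M : GREM n}

section Confinement

variable {N : ℕ} {Ω : Type*}

/-- The centered energies of the levels `1, …, l` all lie in `[-C, C]`. -/
def Confined (X : (J : Finset (Fin n)) → M.Conf N J → Ω → ℝ) (C : ℝ) (l : ℕ) (σ : M.FullConf N)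
    (ω : Ω) : Prop :=
  ∀ i ∈ Finset.Icc 1 l, levelEnergy X i σ ω ∈ Set.Icc (-C) C

variable (M) in
/-- A bound on the probability that a configuration with partial energy `X̂_j` in `[-R, R]` has a
level `l ≤ j` with partial energy above `T`, or a level `l < j` with partial energy below `-L`. -/
def exitBound (j : ℕ) (R T L : ℝ) : ℝ :=
  ∑ l ∈ Finset.Icc 1 j,
      crossingConst M.levelConst M.beta (fun _ => T) l * (Real.exp (-M.beta l * T) / M.beta l) +
    ∑ l ∈ Finset.Ico 1 j,
      crossingConst M.levelConst M.beta (Function.update (fun _ => T) l (-L)) j *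
        (Real.exp (-M.beta j * -R) * (R - -R))

variable (hcover : ∀ i : Fin n, ∃ J ∈ M.P Finset.univ, i ∈ J) {j l : ℕ}

include hcover

lemma exists_exitBound_lt (hj : j ≤ M.K) (R : ℝ) {ε : ℝ} (hε : 0 < ε) :
    ∃ T L : ℝ, 0 ≤ T ∧ 0 ≤ L ∧ M.exitBound j R T L < ε := by
  have hup : Tendsto (fun T => ∑ l ∈ Finset.Icc 1 j, crossingConst M.levelConst M.beta
      (fun _ => T) l * (Real.exp (-M.beta l * T) / M.beta l)) atTop (nhds 0) := by
    rw [← Finset.sum_const_zero (s := Finset.Icc 1 j)]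
    refine tendsto_finsetSum _ fun l hl => ?_
    obtain ⟨hl1, hlj⟩ := Finset.mem_Icc.1 hl
    exact tendsto_crossingConst_const (M.beta_pos hcover le_rfl ((hl1.trans hlj).trans hj)) hl1
  obtain ⟨T, hT, hT0⟩ :=
    ((hup.eventually_lt_const (half_pos hε)).and (eventually_ge_atTop 0)).exists
  have hdown : Tendsto (fun L => ∑ l ∈ Finset.Ico 1 j, crossingConst M.levelConst M.beta
      (Function.update (fun _ => T) l (-L)) j * (Real.exp (-M.beta j * -R) * (R - -R)))
      atTop (nhds 0) := by
    rw [← Finset.sum_const_zero (s := Finset.Ico 1 j)]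
    refine tendsto_finsetSum _ fun l hl => ?_
    obtain ⟨hl1, hlj⟩ := Finset.mem_Ico.1 hl
    rw [← zero_mul (Real.exp (-M.beta j * -R) * (R - -R))]
    exact (tendsto_crossingConst_update _ hl
      (M.beta_lt_beta_succ hcover hl1 (hlj.trans_le hj))).mul_const _
  obtain ⟨L, hL, hL0⟩ :=
    ((hdown.eventually_lt_const (half_pos hε)).and (eventually_ge_atTop 0)).exists
  exact ⟨T, L, hT0, hL0, (add_lt_add hT hL).trans_eq (add_halves ε)⟩

variable {X : (J : Finset (Fin n)) → M.Conf N J → Ω → ℝ} [MeasurableSpace Ω]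
  {Pr : Measure Ω} [IsProbabilityMeasure Pr] (hX : M.IsDisorder Pr X)
  (hm : ∀ J τ, Measurable (X J τ)) (hN : 0 < N)

include hX hm hN

lemma measureReal_exists_partialEnergy_mem_le (hl : 1 ≤ l) (hlK : l ≤ M.K) (t : ℕ → ℝ)
    {E : Set ℝ} (hE : MeasurableSet E) {x : ℝ} (hx : 0 ≤ x)
    (hEx : expWeight (M.beta l) E ≤ ENNReal.ofReal x) :
    Pr.real {ω | ∃ σ, (∀ i ∈ Finset.Ico 1 l, partialEnergy X i σ ω ≤ t i) ∧
      partialEnergy X l σ ω ∈ E} ≤ crossingConst M.levelConst M.beta t l * x := by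
  have hlevelConst : ∀ i ∈ Finset.Icc 1 l, 0 ≤ M.levelConst i := fun i hi =>
    (levelConst_pos hcover (Finset.mem_Icc.1 hi).1 ((Finset.mem_Icc.1 hi).2.trans hlK)).le
  have hbeta : ∀ i ∈ Finset.Ico 1 l, M.beta i < M.beta (i + 1) := fun i hi =>
    M.beta_lt_beta_succ hcover (Finset.mem_Ico.1 hi).1 ((Finset.mem_Ico.1 hi).2.trans_le hlK)
  have hbound : 0 ≤ crossingConst M.levelConst M.beta t l * x :=
    mul_nonneg (crossingConst_nonneg hlevelConst hbeta t) hx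
  have hsingle : ∀ σ, Pr.real {ω | (∀ i ∈ Finset.Ico 1 l, partialEnergy X i σ ω ≤ t i) ∧
      partialEnergy X l σ ω ∈ E} ≤
      crossingConst M.levelConst M.beta t l * x / M.nominalCard N (M.chain l) := fun σ => by
    have hle := measureReal_partialSum_mem_le (𝓕 := levelFiltration hm)
      (V := fun i => levelEnergy X i σ) (Pr := Pr) (b := M.beta)
      (c := fun i => M.levelConst i / M.nominalCard N (M.block i))
      (fun i => measurable_levelEnergy_levelFiltration hm i σ)
      (fun i => indep_levelFiltration_levelEnergy hm hX i σ)
      (fun i hi => div_nonneg (hlevelConst i hi) (M.nominalCard_pos N _).le) hbeta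
      (fun i hi => map_levelEnergy_le hcover (Finset.mem_Icc.1 hi).1
        ((Finset.mem_Icc.1 hi).2.trans hlK) hX hm hN σ) hl t hE hx hEx
    rwa [crossingConst_div, M.prod_nominalCard_block_Icc_one, div_mul_eq_mul_div] at hle
  refine (measureReal_exists_le_card_mul (f := (M.chain l).restrict) (fun σ τ hστ => ?_)
    (div_nonneg hbound (M.nominalCard_pos N _).le) hsingle).trans
    ((mul_le_mul_of_nonneg_right (M.card_conf_le_nominalCard N _)
      (div_nonneg hbound (M.nominalCard_pos N _).le)).trans_eq
      (mul_div_cancel₀ _ (M.nominalCard_pos N _).ne'))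
  have hagree : ∀ i ∈ M.chain l, σ i = τ i := fun i hi => congrFun hστ ⟨i, hi⟩
  ext ω
  refine and_congr (forall₂_congr fun i hi => ?_) ?_
  · rw [partialEnergy_congr fun s hs =>
      hagree s (M.chain_mono (Finset.mem_Ico.1 hi).2.le hs)]
  · rw [partialEnergy_congr hagree]

lemma measureReal_not_confined_le (hj : j ≤ M.K) {R T L : ℝ} (hR : 0 ≤ R) (hT : 0 ≤ T)
    (hL : 0 ≤ L) :
    Pr.real {ω | ∃ σ, partialEnergy X j σ ω ∈ Set.Icc (-R) R ∧
      ¬ Confined X (2 * (R + T + L)) j σ ω} ≤ M.exitBound j R T L := by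
  set up : ℕ → Set Ω := fun l => {ω | ∃ σ, (∀ i ∈ Finset.Ico 1 l, partialEnergy X i σ ω ≤ T) ∧
    partialEnergy X l σ ω ∈ Set.Ici T}
  set down : ℕ → Set Ω := fun l => {ω | ∃ σ, (∀ i ∈ Finset.Ico 1 j,
    partialEnergy X i σ ω ≤ Function.update (fun _ => T) l (-L) i) ∧
    partialEnergy X j σ ω ∈ Set.Icc (-R) R}
  have hsub : {ω | ∃ σ, partialEnergy X j σ ω ∈ Set.Icc (-R) R ∧
      ¬ Confined X (2 * (R + T + L)) j σ ω} ⊆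
      (⋃ l ∈ Finset.Icc 1 j, up l) ∪ ⋃ l ∈ Finset.Ico 1 j, down l := by
    rintro ω ⟨σ, hσ, hout⟩
    simp only [Set.mem_union, Set.mem_iUnion, exists_prop]
    rcases forall_abs_sub_le_or_exists_crossing (x := fun i => partialEnergy X i σ ω)
      Finset.sum_empty hT hL hσ with hconf | ⟨l, hl, hup⟩ | ⟨l, hl, hdown⟩
    · refine absurd (fun i hi => abs_le.1 ?_) hout
      obtain ⟨i, rfl⟩ := Nat.exists_eq_add_of_le' (Finset.mem_Icc.1 hi).1
      have hsum : partialEnergy X (i + 1) σ ω = partialEnergy X i σ ω + levelEnergy X (i + 1) σ ω :=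
        Finset.sum_Icc_succ_top (by omega) _
      simpa [hsum] using hconf (i + 1) hi
    · exact .inl ⟨l, hl, σ, hup⟩
    · exact .inr ⟨l, hl, σ, hdown, hσ⟩
  refine (measureReal_mono hsub).trans ((measureReal_union_le _ _).trans (add_le_add
    ((measureReal_biUnion_finset_le _ _).trans (Finset.sum_le_sum fun l hl => ?_))
    ((measureReal_biUnion_finset_le _ _).trans (Finset.sum_le_sum fun l hl => ?_))))
  · obtain ⟨hl1, hlj⟩ := Finset.mem_Icc.1 hl
    have hβ := M.beta_pos hcover hl1 (hlj.trans hj)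
    exact measureReal_exists_partialEnergy_mem_le hcover hX hm hN hl1 (hlj.trans hj) _
      measurableSet_Ici (by positivity) (expWeight_Ici hβ T).le
  · obtain ⟨hl1, hlj⟩ := Finset.mem_Ico.1 hl
    have hj1 := hl1.trans hlj.le
    exact measureReal_exists_partialEnergy_mem_le hcover hX hm hN hj1 hj _ measurableSet_Icc
      (mul_nonneg (Real.exp_pos _).le (by linarith))
      (expWeight_Icc_le (M.beta_pos hcover hj1 hj).le _ _)

end Confinement

end GREM

namespace GREM

variable {n : ℕ} {M : GREM n} {N k r : ℕ} {S U : Finset (Fin n)}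

section Overlap

variable (M) in
/-- Two configurations can agree exactly on `A_r ∪ S` among the sites of `A_k`, where `S` is the
set of their common sites in `A_k \ A_{k-1}`, and do so in a non-ultrametric way. -/
structure IsOverlap (k r : ℕ) (S : Finset (Fin n)) : Prop where
  lt : r < k
  subset : S ⊆ M.block k
  nonempty : S.Nonempty
  ne : M.chain r ∪ S ≠ M.chain k

variable (M) in
/-- The sets of level `k` contained in `U`: the level-`k` disorder variables that are common to two
configurations which agree exactly on `U`. -/
def shared (k : ℕ) (U : Finset (Fin n)) : Finset (Finset (Fin n)) :=
  (M.level k).filter (· ⊆ U)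

variable (M) in
/-- The variance, divided by `N`, of the energy that is common at level `k` to two configurations
which agree exactly on `U`. -/
def sharedWeight (k : ℕ) (U : Finset (Fin n)) : ℝ := ∑ J ∈ M.shared k U, M.a J

lemma shared_subset_level : M.shared k U ⊆ M.level k := Finset.filter_subset _ _

lemma sum_level_sdiff_shared :
    ∑ J ∈ M.level k \ M.shared k U, M.a J = M.Delta k - M.sharedWeight k U :=
  eq_sub_of_add_eq ((Finset.sum_sdiff shared_subset_level).trans (M.Delta_eq_sum k).symm)

lemma sharedWeight_pos (h : (M.shared k U).Nonempty) : 0 < M.sharedWeight k U :=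
  Finset.sum_pos (fun _ hJ => (mem_level.1 (shared_subset_level hJ)).1.2) h

namespace IsOverlap

variable (h : M.IsOverlap k r S)

include h

lemma one_le : 1 ≤ k := Nat.one_le_of_lt h.lt

lemma union_subset : M.chain r ∪ S ⊆ M.chain k :=
  Finset.union_subset (M.chain_mono h.lt.le) (h.subset.trans Finset.sdiff_subset)

lemma disjoint {l : ℕ} (hl : l < k) : Disjoint (M.chain l) S :=
  (Finset.disjoint_sdiff.mono_left (M.chain_mono (Nat.le_sub_one_of_lt hl))).mono_right h.subset

lemma mem_chain_of_mem_union {i : Fin n} (hi : i ∈ M.chain (k - 1)) (hiU : i ∈ M.chain r ∪ S) :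
    i ∈ M.chain r :=
  (Finset.mem_union.1 hiU).resolve_right
    (Finset.disjoint_left.1 (h.disjoint (Nat.sub_one_lt_of_lt h.lt)) hi)

variable (hcover : ∀ i : Fin n, ∃ J ∈ M.P Finset.univ, i ∈ J) (hirr : M.CondC') (hK : k ≤ M.K)

include hcover hirr hK

lemma exists_mem_level_not_subset : ∃ J ∈ M.level k, ¬ J ⊆ M.chain r ∪ S := by
  by_contra! hall
  rcases (Nat.succ_le_of_lt h.lt).lt_or_eq with hr | rfl
  · obtain ⟨s, hs, J, hJ, hsJ⟩ := hirr k (by omega) hK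
    obtain ⟨hs1, hs2⟩ := Finset.mem_sdiff.1 hs
    exact hs2 (M.chain_mono (by omega) (h.mem_chain_of_mem_union hs1 (hall J hJ hsJ)))
  · have halpha : M.alpha (M.chain r ∪ S) = M.alpha (M.chain (r + 1)) := by
      refine le_antisymm (M.alpha_mono h.union_subset) (Finset.sum_le_sum_of_subset_of_nonneg
        (fun J hJ => ?_) fun J _ _ => M.a_nonneg J)
      by_cases hJr : J ⊆ M.chain r
      · exact M.mem_P.2 ⟨hJr.trans Finset.subset_union_left, (M.mem_P.1 hJ).2⟩
      · exact M.mem_P.2 ⟨hall J (mem_level.2 ⟨M.mem_P.1 hJ, hJr⟩), (M.mem_P.1 hJ).2⟩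
    have hexcess := M.excess_beta_nonneg hcover h.one_le hK
      (Finset.subset_union_left : M.chain r ⊆ M.chain r ∪ S)
    have hcritical := M.beta_sq_mul_Delta hcover h.one_le hK
    have hgam := M.gam_lt_gam (h.union_subset.ssubset_of_ne h.ne)
    rw [block, ← M.gam_sub_gam (M.chain_sub_one_subset _), Delta] at hcritical
    rw [excess, halpha, hcritical] at hexcess
    nlinarith [Real.log_pos one_lt_two]

lemma sharedWeight_lt_Delta : M.sharedWeight k (M.chain r ∪ S) < M.Delta k := by
  obtain ⟨J, hJ, hJU⟩ := h.exists_mem_level_not_subset hcover hirr hK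
  rw [← sub_pos, ← sum_level_sdiff_shared]
  refine Finset.sum_pos (fun J hJ => (mem_level.1 (Finset.mem_sdiff.1 hJ).1).1.2)
    ⟨J, Finset.mem_sdiff.2 ⟨hJ, fun hJs => hJU (Finset.mem_filter.1 hJs).2⟩⟩

end IsOverlap

variable (M) in
/-- The pairs of configurations that agree exactly on `U` among the sites of `A_k`. -/
abbrev OverlapPair (N k : ℕ) (U : Finset (Fin n)) : Type :=
  {p : M.FullConf N × M.FullConf N // ∀ i ∈ M.chain k, p.1 i = p.2 i ↔ i ∈ U}

namespace OverlapPair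

lemma exists_ne_of_not_subset (x : M.OverlapPair N k U) {J : Finset (Fin n)}
    (hJ : J ⊆ M.chain k) (hJU : ¬ J ⊆ U) : ∃ i ∈ J, x.1.1 i ≠ x.1.2 i := by
  obtain ⟨i, hiJ, hiU⟩ := Finset.not_subset.1 hJU
  exact ⟨i, hiJ, fun heq => hiU ((x.2 i (hJ hiJ)).1 heq)⟩

lemma exists_ne_of_mem_level (h : M.IsOverlap k r S) (x : M.OverlapPair N k (M.chain r ∪ S))
    {l : ℕ} (hrl : r < l) (hlk : l < k) {J : Finset (Fin n)} (hJ : J ∈ M.level l) :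
    ∃ i ∈ J, x.1.1 i ≠ x.1.2 i := by
  have hJl := M.subset_of_mem_level hJ
  refine x.exists_ne_of_not_subset (hJl.trans (M.chain_mono hlk.le)) fun hJU =>
    (mem_level.1 hJ).2 fun i hi => M.chain_mono (Nat.le_sub_one_of_lt hrl) ?_
  exact h.mem_chain_of_mem_union (M.chain_mono (Nat.le_sub_one_of_lt hlk) (hJl hi)) (hJU hi)

/-- The restrictions that determine both configurations of the pair on `A_k`. -/
def code (x : M.OverlapPair N k U) : M.Conf N (M.chain k) × M.Conf N (M.chain k \ U) :=
  ((M.chain k).restrict x.1.1, (M.chain k \ U).restrict x.1.2)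

lemma eq_on_chain_of_code_eq {x y : M.OverlapPair N k U} (h : x.code = y.code) {i : Fin n}
    (hi : i ∈ M.chain k) : x.1.1 i = y.1.1 i ∧ x.1.2 i = y.1.2 i := by
  obtain ⟨hfst, hsnd⟩ := Prod.ext_iff.1 h
  have hfst_i : x.1.1 i = y.1.1 i := congrFun hfst ⟨i, hi⟩
  refine ⟨hfst_i, ?_⟩
  by_cases hiU : i ∈ U
  · rw [← (x.2 i hi).2 hiU, ← (y.2 i hi).2 hiU, hfst_i]
  · exact congrFun hsnd ⟨i, Finset.mem_sdiff.2 ⟨hi, hiU⟩⟩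

end OverlapPair

lemma IsOverlap.card_code_le (h : M.IsOverlap k r S) :
    (Fintype.card (M.Conf N (M.chain k) × M.Conf N (M.chain k \ (M.chain r ∪ S))) : ℝ) ≤
      M.nominalCard N (M.chain k) ^ 2 / (M.nominalCard N (M.chain r) * M.nominalCard N S) := by
  have hpos := mul_pos (M.nominalCard_pos N (M.chain r)) (M.nominalCard_pos N S)
  have hsplit : M.nominalCard N (M.chain k) = M.nominalCard N (M.chain k \ (M.chain r ∪ S)) *
      (M.nominalCard N (M.chain r) * M.nominalCard N S) := by
    rw [← M.nominalCard_union N (h.disjoint h.lt), ← M.nominalCard_union N Finset.sdiff_disjoint,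
      Finset.sdiff_union_of_subset h.union_subset]
  rw [Fintype.card_prod, Nat.cast_mul, sq, mul_div_assoc, ← (eq_div_iff hpos.ne').2 hsplit.symm]
  exact mul_le_mul (M.card_conf_le_nominalCard N _) (M.card_conf_le_nominalCard N _)
    (Nat.cast_nonneg _) (M.nominalCard_pos N _).le

end Overlap

end GREM

namespace GREM

variable {n : ℕ} {M : GREM n} {N k r : ℕ} {S U : Finset (Fin n)}

section PairConstants

variable (M)

/-- The level at which the energy shared by two configurations agreeing exactly on `U` is
truncated. Only about `nominalCard N S` values of this energy matter, where `S` is the part of `U`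
in `A_k \ A_{k-1}`, and with high probability none of them exceeds the truncation level. -/
def energyCut (N k : ℕ) (U S : Finset (Fin n)) : ℝ :=
  M.beta k * M.sharedWeight k U * N / 2 + Real.log 2 * M.gam S * N / M.beta k

/-- Up to the factor `(nominalCard N S)⁻¹ / √N`, a bound on the probability that the shared energy
of a pair exceeds `energyCut N k U S`. -/
def tailConst (k : ℕ) (U : Finset (Fin n)) : ℝ :=
  (√(2 * Real.pi * M.sharedWeight k U))⁻¹ / M.beta k

/-- Up to the factor `nominalCard N S / (nominalCard N (block k)) ^ 2 / √N`, a bound on the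
probability that both centered energies of level `k` of a pair lie in `[-C, C]` while the shared
energy is below `energyCut N k U S`. -/
def pairConst (C : ℝ) (k : ℕ) (U : Finset (Fin n)) : ℝ :=
  M.tailConst k U * M.windowConst C k ^ 2 * (M.Delta k / (M.Delta k - M.sharedWeight k U))

variable {M}

lemma exp_beta_mul_energyCut (hβ : 0 < M.beta k) :
    Real.exp (M.beta k * M.energyCut N k U S) =
      Real.exp (M.beta k ^ 2 * (M.sharedWeight k U * N) / 2) * M.nominalCard N S := by
  rw [nominalCard_eq_exp, ← Real.exp_add, energyCut]
  congr 1
  field_simp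

lemma gaussConst_sharedWeight_mul_exp (hβ : 0 < M.beta k) :
    gaussConst (M.beta k) (M.sharedWeight k U * N) *
      (Real.exp (-M.beta k * M.energyCut N k U S) / M.beta k) =
      M.tailConst k U / √N / M.nominalCard N S := by
  rw [neg_mul, Real.exp_neg, exp_beta_mul_energyCut hβ, gaussConst, tailConst, ← mul_assoc,
    Real.sqrt_mul' _ (Nat.cast_nonneg N)]
  have := (Real.exp_pos (M.beta k ^ 2 * (M.sharedWeight k U * N) / 2)).ne'
  have := (M.nominalCard_pos N S).ne'
  field_simp

lemma gaussConst_sq (b : ℝ) {v : ℝ} (hv : 0 ≤ v) :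
    gaussConst b v ^ 2 = (2 * Real.pi * v)⁻¹ * Real.exp (b ^ 2 * v) := by
  rw [gaussConst, mul_pow, inv_pow, Real.sq_sqrt (by positivity), Real.exp_half,
    Real.sq_sqrt (Real.exp_pos _).le]

lemma gaussConst_shared_mul_unshared_eq (hcover : ∀ i : Fin n, ∃ J ∈ M.P Finset.univ, i ∈ J)
    (hk : 1 ≤ k) (hK : k ≤ M.K) (hlt : M.sharedWeight k U < M.Delta k) (hN : 0 < N) (C : ℝ) :
    gaussConst (M.beta k) (M.sharedWeight k U * N) *
      (gaussConst (M.beta k) ((M.Delta k - M.sharedWeight k U) * N) *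
        (Real.exp (-M.beta k * (M.aN N k - C)) * (2 * C))) ^ 2 *
      (Real.exp (M.beta k * M.energyCut N k U S) / M.beta k) =
      M.pairConst C k U / √N * (M.nominalCard N S / M.nominalCard N (M.block k) ^ 2) := by
  have hβ := M.beta_pos hcover hk hK
  have hΔ := M.Delta_pos hcover hk hK
  have hgap := sub_pos.2 hlt
  have hN' : (0 : ℝ) < N := Nat.cast_pos.2 hN
  have hcard := M.nominalCard_pos N (M.block k)
  have hunshared : Real.exp (M.beta k ^ 2 * ((M.Delta k - M.sharedWeight k U) * N)) =
      M.nominalCard N (M.block k) ^ 2 /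
        Real.exp (M.beta k ^ 2 * (M.sharedWeight k U * N) / 2) ^ 2 := by
    rw [← exp_beta_sq_mul_Delta hcover hk hK, ← Real.exp_nat_mul, ← Real.exp_sub]
    ring_nf
  have hcentering : Real.exp (-M.beta k * (M.aN N k - C)) =
      √N / (M.nominalCard N (M.block k) ^ 2 * (M.beta k * √(2 * Real.pi * M.Delta k))) *
        Real.exp (M.beta k * C) := by
    rw [← exp_neg_beta_mul_aN hcover hk hK hN, ← Real.exp_add]
    ring_nf
  have hsqrtΔ : √(2 * Real.pi * M.Delta k) ^ 2 = 2 * Real.pi * M.Delta k :=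
    Real.sq_sqrt (by positivity)
  have hsqrtN : √(N : ℝ) ^ 2 = N := Real.sq_sqrt hN'.le
  rw [mul_pow, gaussConst_sq _ (by positivity), exp_beta_mul_energyCut hβ, hunshared, hcentering,
    gaussConst, pairConst, tailConst, windowConst, levelConst, ← mul_assoc (2 * Real.pi) _ (N : ℝ),
    Real.sqrt_mul' _ hN'.le]
  have := Real.exp_pos (M.beta k ^ 2 * (M.sharedWeight k U * N) / 2)
  simp only [mul_pow, div_pow, hsqrtN, hsqrtΔ]
  field_simp

end PairConstants

end GREM

namespace GREM

variable {n : ℕ} {M : GREM n} {N k r : ℕ} {S U : Finset (Fin n)} {Ω : Type*}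
  {X : (J : Finset (Fin n)) → M.Conf N J → Ω → ℝ}

section OverlapPairs

lemma measurable_energyOn_levelSigma {L : Finset (Finset (Fin n))} (hL : L ⊆ M.level k)
    (σ : M.FullConf N) : Measurable[levelSigma X k] (energyOn X L σ) :=
  measurable_energyOn_disorderSigma (hL.trans (level_subset_P k)) fun _ hp => hL hp.1

lemma measurableSet_levelEnergy_mem (C : ℝ) (l : ℕ) (σ : M.FullConf N) :
    MeasurableSet[levelSigma X l] {ω | levelEnergy X l σ ω ∈ Set.Icc (-C) C} :=
  measurable_levelEnergy_levelSigma l σ measurableSet_Icc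

/-- Both centered energies of level `k` of the pair lie in `[-C, C]`. -/
def windowPairEvent (X : (J : Finset (Fin n)) → M.Conf N J → Ω → ℝ) (C : ℝ)
    (x : M.OverlapPair N k U) : Set Ω :=
  {ω | levelEnergy X k x.1.1 ω ∈ Set.Icc (-C) C ∧ levelEnergy X k x.1.2 ω ∈ Set.Icc (-C) C}

/-- Both centered energies of level `k` of the pair lie in `[-C, C]`, while its shared energy is
below the truncation level `energyCut N k U S`. -/
def truncatedPairEvent (X : (J : Finset (Fin n)) → M.Conf N J → Ω → ℝ) (C : ℝ)
    (S : Finset (Fin n)) (x : M.OverlapPair N k U) : Set Ω :=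
  {ω | energyOn X (M.shared k U) x.1.1 ω ≤ M.energyCut N k U S} ∩ windowPairEvent X C x

lemma measurableSet_windowPairEvent (C : ℝ) (x : M.OverlapPair N k U) :
    MeasurableSet[levelSigma X k] (windowPairEvent X C x) :=
  (measurableSet_levelEnergy_mem C k _).inter (measurableSet_levelEnergy_mem C k _)

lemma measurableSet_truncatedPairEvent (C : ℝ) (x : M.OverlapPair N k U) :
    MeasurableSet[levelSigma X k] (truncatedPairEvent X C S x) :=
  (measurable_energyOn_levelSigma shared_subset_level _ measurableSet_Iic).inter
    (measurableSet_windowPairEvent C x)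

lemma windowPairEvent_factorsThrough_code (C : ℝ) :
    (windowPairEvent (N := N) (k := k) (U := U) X C).FactorsThrough OverlapPair.code :=
  fun x y hxy => by
    unfold windowPairEvent
    rw [levelEnergy_congr fun i hi => (OverlapPair.eq_on_chain_of_code_eq hxy hi).1,
      levelEnergy_congr (σ := x.1.2) fun i hi => (OverlapPair.eq_on_chain_of_code_eq hxy hi).2]

lemma truncatedPairEvent_factorsThrough_code (C : ℝ) :
    (truncatedPairEvent (N := N) (k := k) (U := U) X C S).FactorsThrough OverlapPair.code :=
  fun x y hxy => by
    have henergy : energyOn X (M.shared k U) x.1.1 = energyOn X (M.shared k U) y.1.1 :=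
      energyOn_congr fun J hJ i hi => (OverlapPair.eq_on_chain_of_code_eq hxy
        (M.subset_of_mem_level (shared_subset_level hJ) hi)).1
    rw [truncatedPairEvent, truncatedPairEvent, henergy, windowPairEvent_factorsThrough_code C hxy]

lemma levelEnergy_mem_Icc_iff (U : Finset (Fin n)) (C : ℝ) (σ : M.FullConf N) (ω : Ω) :
    levelEnergy X k σ ω ∈ Set.Icc (-C) C ↔
      energyOn X (M.shared k U) σ ω + energyOn X (M.level k \ M.shared k U) σ ω ∈
        Set.Icc (M.aN N k - C) (M.aN N k + C) := by
  rw [← energyOn_union Finset.disjoint_sdiff, Finset.union_sdiff_of_subset shared_subset_level,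
    levelEnergy, Set.mem_Icc, Set.mem_Icc, le_sub_iff_add_le', sub_le_iff_le_add',
    ← sub_eq_add_neg]

lemma OverlapPair.energyOn_shared_eq (x : M.OverlapPair N k U) :
    energyOn X (M.shared k U) x.1.2 = energyOn X (M.shared k U) x.1.1 :=
  energyOn_congr fun J hJ i hi => by
    obtain ⟨hJl, hJU⟩ := Finset.mem_filter.1 hJ
    exact ((x.2 i (M.subset_of_mem_level hJl hi)).2 (hJU hi)).symm

variable [MeasurableSpace Ω] {Pr : Measure Ω} (hX : M.IsDisorder Pr X)
  (hm : ∀ J τ, Measurable (X J τ))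

include hX hm

lemma OverlapPair.indepFun_unshared (x : M.OverlapPair N k U) :
    IndepFun (energyOn X (M.level k \ M.shared k U) x.1.1)
      (energyOn X (M.level k \ M.shared k U) x.1.2) Pr := by
  have hP : M.level k \ M.shared k U ⊆ M.P Finset.univ :=
    Finset.sdiff_subset.trans (level_subset_P k)
  refine indepFun_of_disjoint hX hm (disjoint_energyIndices fun J hJ _ => ?_)
    (measurable_energyOn_disorderSigma hP le_rfl) (measurable_energyOn_disorderSigma hP le_rfl)
  obtain ⟨hJl, hJs⟩ := Finset.mem_sdiff.1 hJ
  exact x.exists_ne_of_not_subset (M.subset_of_mem_level hJl)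
    fun hJU => hJs (Finset.mem_filter.2 ⟨hJl, hJU⟩)

lemma OverlapPair.indepFun_shared_unshared (x : M.OverlapPair N k U) :
    IndepFun (energyOn X (M.shared k U) x.1.1)
      (fun ω => (energyOn X (M.level k \ M.shared k U) x.1.1 ω,
        energyOn X (M.level k \ M.shared k U) x.1.2 ω)) Pr := by
  have hP : M.level k \ M.shared k U ⊆ M.P Finset.univ :=
    Finset.sdiff_subset.trans (level_subset_P k)
  exact indepFun_of_disjoint hX hm (Set.disjoint_union_right.2
      ⟨disjoint_energyIndices_of_disjoint Finset.disjoint_sdiff _ _,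
        disjoint_energyIndices_of_disjoint Finset.disjoint_sdiff _ _⟩)
    (measurable_energyOn_disorderSigma (shared_subset_level.trans (level_subset_P k)) le_rfl)
    ((measurable_energyOn_disorderSigma hP Set.subset_union_left).prodMk
      (measurable_energyOn_disorderSigma hP Set.subset_union_right))

variable [IsProbabilityMeasure Pr]

lemma measureReal_forall_levels_inter_le {W : ℕ → Set Ω} {F : Set Ω} {p : ℕ → ℝ} {q : ℝ}
    {s : Finset ℕ} (hks : k ∉ s) (hW : ∀ i ∈ s, MeasurableSet[levelSigma X i] (W i))
    (hF : MeasurableSet[levelSigma X k] F) (hWp : ∀ i ∈ s, Pr.real (W i) ≤ p i)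
    (hFq : Pr.real F ≤ q) :
    Pr.real {ω | (∀ i ∈ s, ω ∈ W i) ∧ ω ∈ F} ≤ (∏ i ∈ s, p i) * q := by
  have hne : ∀ i ∈ s, Function.update W k F i = W i := fun i hi =>
    Function.update_of_ne (ne_of_mem_of_not_mem hi hks) _ _
  have hset : {ω | (∀ i ∈ s, ω ∈ W i) ∧ ω ∈ F} =
      ⋂ i ∈ insert k s, Function.update W k F i := by
    rw [Finset.set_biInter_insert, Function.update_self, Set.iInter₂_congr hne]
    ext ω
    simp [and_comm]
  have hmeas : ∀ i ∈ insert k s, MeasurableSet[levelSigma X i] (Function.update W k F i) := by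
    refine (Finset.forall_mem_insert _ _ _).2 ⟨by rwa [Function.update_self], fun i hi => ?_⟩
    rw [hne i hi]
    exact hW i hi
  rw [hset, measureReal_biInter_levels hm hX _ hmeas, Finset.prod_insert hks,
    Function.update_self, Finset.prod_congr rfl fun i hi => by rw [hne i hi], mul_comm]
  exact mul_le_mul (Finset.prod_le_prod (fun _ _ => measureReal_nonneg) hWp) hFq
    measureReal_nonneg
    (Finset.prod_nonneg fun i hi => measureReal_nonneg.trans (hWp i hi))

variable (hcover : ∀ i : Fin n, ∃ J ∈ M.P Finset.univ, i ∈ J) (hN : 0 < N) {C : ℝ}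

include hcover hN

section Shared

variable (hk : 1 ≤ k) (hK : k ≤ M.K) (hU : (M.shared k U).Nonempty)

include hk hK hU

lemma measureReal_energyCut_le (σ : M.FullConf N) :
    Pr.real {ω | M.energyCut N k U S ≤ energyOn X (M.shared k U) σ ω} ≤
      M.tailConst k U / √N / M.nominalCard N S := by
  have hβ := M.beta_pos hcover hk hK
  have hle := measureReal_Ici_le_of_le_expWeight hβ (gaussConst_nonneg _ _)
    (map_energyOn_le hX hm (shared_subset_level.trans (level_subset_P k)) σ (M.beta k)
      (mul_pos (sharedWeight_pos hU) (Nat.cast_pos.2 hN))) (M.energyCut N k U S)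
  rwa [map_measureReal_apply (measurable_energyOn hm _ σ) measurableSet_Ici,
    ← sharedWeight, gaussConst_sharedWeight_mul_exp hβ] at hle

lemma measureReal_truncatedPairEvent_le (hC : 0 ≤ C) (hlt : M.sharedWeight k U < M.Delta k)
    (x : M.OverlapPair N k U) :
    Pr.real (truncatedPairEvent X C S x) ≤
      M.pairConst C k U / √N * (M.nominalCard N S / M.nominalCard N (M.block k) ^ 2) := by
  have hN' : (0 : ℝ) < N := Nat.cast_pos.2 hN
  have hlaw : ∀ σ, Pr.map (energyOn X (M.level k \ M.shared k U) σ) ≤ ENNReal.ofReal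
      (gaussConst (M.beta k) ((M.Delta k - M.sharedWeight k U) * N)) • expWeight (M.beta k) :=
    fun σ => by
      rw [← sum_level_sdiff_shared]
      exact map_energyOn_le hX hm (Finset.sdiff_subset.trans (level_subset_P k)) σ _
        (mul_pos (sum_level_sdiff_shared.symm ▸ sub_pos.2 hlt) hN')
  have hle := measureReal_shared_le (measurable_energyOn hm _ x.1.1)
    (measurable_energyOn hm _ x.1.1) (measurable_energyOn hm _ x.1.2)
    (x.indepFun_shared_unshared hX hm) (x.indepFun_unshared hX hm)
    (M.beta_pos hcover hk hK) (gaussConst_nonneg _ _) (gaussConst_nonneg _ _)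
    (map_energyOn_le hX hm (shared_subset_level.trans (level_subset_P k)) x.1.1 (M.beta k)
      (mul_pos (sharedWeight_pos hU) hN'))
    (hlaw x.1.1) (hlaw x.1.2)
    (by linarith : M.aN N k - C ≤ M.aN N k + C) (M.energyCut N k U S)
  rw [← sharedWeight, add_sub_sub_cancel, ← two_mul,
    gaussConst_shared_mul_unshared_eq hcover hk hK hlt hN] at hle
  simpa only [truncatedPairEvent, windowPairEvent, ← Set.ofPred_and,
    levelEnergy_mem_Icc_iff U, x.energyOn_shared_eq] using hle

end Shared

end OverlapPairs

end GREM

namespace GREM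

variable {n : ℕ} {M : GREM n} {N k r : ℕ} {S : Finset (Fin n)} {Ω : Type*}
  {X : (J : Finset (Fin n)) → M.Conf N J → Ω → ℝ} {C : ℝ}

section OverlapBound

variable (M) in
/-- Up to powers of `nominalCard`, a bound on the probability that, at the levels below `k`, both
configurations of a pair that splits at level `r` have centered energies in `[-C, C]`. -/
def pairWindowConst (C : ℝ) (r k : ℕ) : ℝ :=
  (∏ i ∈ Finset.Icc 1 (k - 1), M.windowConst C i) *
    ∏ i ∈ Finset.Icc (r + 1) (k - 1), M.windowConst C i

variable (M) in
open Classical in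
/-- A bound on the probability that some pair of configurations agreeing exactly on `A_r ∪ S` among
the sites of `A_k` has all its centered energies of the levels up to `k` in `[-C, C]`. -/
def overlapBound (C : ℝ) (k r : ℕ) (S : Finset (Fin n)) (N : ℕ) : ℝ :=
  if (M.shared k (M.chain r ∪ S)).Nonempty then
    ((∏ i ∈ Finset.Icc 1 (k - 1), M.windowConst C i) * M.tailConst k (M.chain r ∪ S) +
      M.pairWindowConst C r k * M.pairConst C k (M.chain r ∪ S)) / √N
  else M.pairWindowConst C r k * M.windowConst C k ^ 2 / M.nominalCard N S

lemma prod_windowConst_div_nominalCard (C : ℝ) (hr : r ≤ k - 1) :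
    ∏ i ∈ Finset.Icc 1 (k - 1), (M.windowConst C i / M.nominalCard N (M.block i) *
        if r < i then M.windowConst C i / M.nominalCard N (M.block i) else 1) =
      M.pairWindowConst C r k *
        (M.nominalCard N (M.chain r) / M.nominalCard N (M.chain (k - 1)) ^ 2) := by
  have hfilter : (Finset.Icc 1 (k - 1)).filter (r < ·) = Finset.Icc (r + 1) (k - 1) := by
    ext i
    simp only [Finset.mem_filter, Finset.mem_Icc]
    omega
  have hcard := M.prod_nominalCard_block N hr
  rw [Finset.prod_mul_distrib, ← Finset.prod_filter, hfilter, Finset.prod_div_distrib,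
    Finset.prod_div_distrib, prod_nominalCard_block_Icc_one, pairWindowConst,
    eq_div_of_mul_eq (M.nominalCard_pos N _).ne' ((mul_comm _ _).trans hcard)]
  have := M.nominalCard_pos N (M.chain r)
  have := M.nominalCard_pos N (M.chain (k - 1))
  field_simp

section Nonneg

variable (hcover : ∀ i : Fin n, ∃ J ∈ M.P Finset.univ, i ∈ J) (hC : 0 ≤ C) (hK : k ≤ M.K)

include hcover hK

lemma tailConst_nonneg (hk : 1 ≤ k) (U : Finset (Fin n)) : 0 ≤ M.tailConst k U := by
  have := M.beta_pos hcover hk hK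
  unfold tailConst
  positivity

lemma pairConst_nonneg (hk : 1 ≤ k) {U : Finset (Fin n)}
    (hlt : M.sharedWeight k U < M.Delta k) : 0 ≤ M.pairConst C k U :=
  mul_nonneg (mul_nonneg (tailConst_nonneg hcover hK hk U) (sq_nonneg _))
    (div_nonneg (M.Delta_pos hcover hk hK).le (sub_pos.2 hlt).le)

include hC

lemma prod_windowConst_nonneg {l : ℕ} (hl : 1 ≤ l) :
    0 ≤ ∏ i ∈ Finset.Icc l (k - 1), M.windowConst C i :=
  Finset.prod_nonneg fun i hi => by
    have := Finset.mem_Icc.1 hi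
    exact windowConst_nonneg hcover (by omega) (by omega) hC

lemma pairWindowConst_nonneg (r : ℕ) : 0 ≤ M.pairWindowConst C r k :=
  mul_nonneg (prod_windowConst_nonneg hcover hC hK le_rfl)
    (prod_windowConst_nonneg hcover hC hK (by omega))

end Nonneg

lemma tendsto_overlapBound (hS : S.Nonempty) :
    Tendsto (M.overlapBound C k r S) atTop (nhds 0) := by
  unfold overlapBound
  split_ifs
  · exact (Real.tendsto_sqrt_atTop.comp tendsto_natCast_atTop_atTop).const_div_atTop _
  · refine Tendsto.const_div_atTop ?_ _
    simp only [nominalCard_eq_exp]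
    exact Real.tendsto_exp_atTop.comp (tendsto_natCast_atTop_atTop.const_mul_atTop
      (mul_pos (Real.log_pos one_lt_two) (M.gam_pos hS)))

lemma Confined.mono {l l' : ℕ} {σ : M.FullConf N} {ω : Ω} (h : Confined X C l σ ω)
    (hl : l' ≤ l) : Confined X C l' σ ω :=
  fun i hi => h i (Finset.Icc_subset_Icc_right hl hi)

lemma confined_congr {l : ℕ} {σ τ : M.FullConf N} {ω : Ω} (h : ∀ i ∈ M.chain l, σ i = τ i) :
    Confined X C l σ ω ↔ Confined X C l τ ω :=
  forall₂_congr fun i hi => by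
    rw [levelEnergy_congr fun s hs => h s (M.chain_mono (Finset.mem_Icc.1 hi).2 hs)]

variable [MeasurableSpace Ω] {Pr : Measure Ω} [IsProbabilityMeasure Pr]
  (hX : M.IsDisorder Pr X) (hm : ∀ J τ, Measurable (X J τ))
  (hcover : ∀ i : Fin n, ∃ J ∈ M.P Finset.univ, i ∈ J) (hN : 0 < N) (hC : 0 ≤ C)
  (hK : k ≤ M.K)

include hX hm hcover hN hC hK

lemma measureReal_pair_levelEnergy_mem_Icc_le (hk : 1 ≤ k) {σ τ : M.FullConf N}
    (hne : ∀ J ∈ M.level k, ∃ i ∈ J, σ i ≠ τ i) :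
    Pr.real {ω | levelEnergy X k σ ω ∈ Set.Icc (-C) C ∧
      levelEnergy X k τ ω ∈ Set.Icc (-C) C} ≤
      (M.windowConst C k / M.nominalCard N (M.block k)) ^ 2 := by
  have hind : IndepFun (energyOn X (M.level k) σ) (energyOn X (M.level k) τ) Pr :=
    indepFun_of_disjoint hX hm (disjoint_energyIndices fun J hJ _ => hne J hJ)
      (measurable_energyOn_disorderSigma (level_subset_P k) le_rfl)
      (measurable_energyOn_disorderSigma (level_subset_P k) le_rfl)
  have hwindow := measureReal_levelEnergy_mem_Icc_le hcover hk hK hX hm hN hC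
  have hprod := (hind.comp (measurable_id.sub_const (M.aN N k))
    (measurable_id.sub_const (M.aN N k))).measure_inter_preimage_eq_mul (Set.Icc (-C) C)
      (Set.Icc (-C) C) measurableSet_Icc measurableSet_Icc
  refine (congrArg ENNReal.toReal hprod).trans_le ?_
  rw [ENNReal.toReal_mul, sq]
  exact mul_le_mul (hwindow σ) (hwindow τ) measureReal_nonneg
    (measureReal_nonneg.trans (hwindow σ))

lemma measureReal_confined_inter_le (hk : 1 ≤ k) {F : Set Ω} {q : ℝ}
    (hF : MeasurableSet[levelSigma X k] F) (hFq : Pr.real F ≤ q) (σ : M.FullConf N) :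
    Pr.real {ω | Confined X C (k - 1) σ ω ∧ ω ∈ F} ≤
      (∏ i ∈ Finset.Icc 1 (k - 1), M.windowConst C i) / M.nominalCard N (M.chain (k - 1)) * q := by
  rw [← M.prod_nominalCard_block_Icc_one, ← Finset.prod_div_distrib]
  refine measureReal_forall_levels_inter_le hX hm (by simp; omega)
    (fun i _ => measurableSet_levelEnergy_mem C i σ) hF (fun i hi => ?_) hFq
  obtain ⟨hi1, hik⟩ := Finset.mem_Icc.1 hi
  exact measureReal_levelEnergy_mem_Icc_le hcover hi1 (by omega) hX hm hN hC σ

lemma measureReal_pair_confined_inter_le (h : M.IsOverlap k r S)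
    (x : M.OverlapPair N k (M.chain r ∪ S)) {F : Set Ω} {q : ℝ}
    (hF : MeasurableSet[levelSigma X k] F) (hFq : Pr.real F ≤ q) :
    Pr.real {ω | (Confined X C (k - 1) x.1.1 ω ∧ Confined X C (k - 1) x.1.2 ω) ∧ ω ∈ F} ≤
      M.pairWindowConst C r k *
        (M.nominalCard N (M.chain r) / M.nominalCard N (M.chain (k - 1)) ^ 2) * q := by
  set w : ℕ → ℝ := fun i => M.windowConst C i / M.nominalCard N (M.block i)
  set W : ℕ → Set Ω := fun i => {ω | levelEnergy X i x.1.1 ω ∈ Set.Icc (-C) C ∧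
    (r < i → levelEnergy X i x.1.2 ω ∈ Set.Icc (-C) C)}
  have hW : ∀ i ∈ Finset.Icc 1 (k - 1), MeasurableSet[levelSigma X i] (W i) := fun i _ =>
    (measurableSet_levelEnergy_mem C i _).inter
      ((MeasurableSet.const _).imp (measurableSet_levelEnergy_mem C i _))
  have hWw : ∀ i ∈ Finset.Icc 1 (k - 1), Pr.real (W i) ≤ w i * if r < i then w i else 1 := by
    intro i hi
    obtain ⟨hi1, hik⟩ := Finset.mem_Icc.1 hi
    split_ifs with hri
    · simpa [W, hri, w, sq] using measureReal_pair_levelEnergy_mem_Icc_le hX hm hcover hN hC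
        (by omega) hi1 fun J hJ => x.exists_ne_of_mem_level h hri (by omega) hJ
    · simpa [W, hri] using
        measureReal_levelEnergy_mem_Icc_le hcover hi1 (by omega) hX hm hN hC x.1.1
  have hsub : {ω | (Confined X C (k - 1) x.1.1 ω ∧ Confined X C (k - 1) x.1.2 ω) ∧ ω ∈ F} ⊆
      {ω | (∀ i ∈ Finset.Icc 1 (k - 1), ω ∈ W i) ∧ ω ∈ F} := fun ω hω =>
    ⟨fun i hi => ⟨hω.1.1 i hi, fun _ => hω.1.2 i hi⟩, hω.2⟩
  rw [← prod_windowConst_div_nominalCard C (Nat.le_sub_one_of_lt h.lt)]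
  exact (measureReal_mono hsub).trans
    (measureReal_forall_levels_inter_le hX hm (by have := h.lt; simp; omega) hW hF hWw hFq)

section Overlap

variable (h : M.IsOverlap k r S)

include h

lemma measureReal_exists_confined_energyCut_le (hU : (M.shared k (M.chain r ∪ S)).Nonempty) :
    Pr.real {ω | ∃ σ, Confined X C (k - 1) σ ω ∧ M.energyCut N k (M.chain r ∪ S) S ≤
      energyOn X (M.shared k (M.chain r ∪ S)) σ ω} ≤
      (∏ i ∈ Finset.Icc 1 (k - 1), M.windowConst C i) * (M.tailConst k (M.chain r ∪ S) / √N) := by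
  set p := (∏ i ∈ Finset.Icc 1 (k - 1), M.windowConst C i) / M.nominalCard N (M.chain (k - 1)) *
    (M.tailConst k (M.chain r ∪ S) / √N / M.nominalCard N S) with hp
  have hsingle : ∀ σ, Pr.real {ω | Confined X C (k - 1) σ ω ∧ ω ∈
      energyOn X (M.shared k (M.chain r ∪ S)) σ ⁻¹' Set.Ici (M.energyCut N k (M.chain r ∪ S) S)} ≤
      p := fun σ =>
    measureReal_confined_inter_le hX hm hcover hN hC hK h.one_le
      (measurable_energyOn_levelSigma shared_subset_level σ measurableSet_Ici)
      (measureReal_energyCut_le hX hm hcover hN h.one_le hK hU σ) σ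
  have hp0 : 0 ≤ p := by
    have := prod_windowConst_nonneg hcover hC hK le_rfl
    have := tailConst_nonneg hcover hK h.one_le (M.chain r ∪ S)
    have := M.nominalCard_pos N (M.chain (k - 1))
    have := M.nominalCard_pos N S
    positivity
  refine (measureReal_exists_le_card_mul (f := (M.chain (k - 1) ∪ S).restrict)
    (fun σ τ hστ => ?_) hp0 hsingle).trans
    ((mul_le_mul_of_nonneg_right (M.card_conf_le_nominalCard N _) hp0).trans_eq ?_)
  · have hagree : ∀ i ∈ M.chain (k - 1) ∪ S, σ i = τ i := fun i hi => congrFun hστ ⟨i, hi⟩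
    have henergy : energyOn X (M.shared k (M.chain r ∪ S)) σ =
        energyOn X (M.shared k (M.chain r ∪ S)) τ := energyOn_congr fun J hJ i hi => hagree i
      (Finset.union_subset_union_left (M.chain_mono (Nat.le_sub_one_of_lt h.lt))
        ((Finset.mem_filter.1 hJ).2 hi))
    ext ω
    refine and_congr (confined_congr fun i hi => hagree i (Finset.mem_union_left _ hi)) ?_
    rw [henergy]
  · have := M.nominalCard_pos N (M.chain (k - 1))
    have := M.nominalCard_pos N S
    rw [hp, M.nominalCard_union N (h.disjoint (Nat.sub_one_lt_of_lt h.lt))]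
    field_simp

lemma measureReal_exists_overlapPair_inter_le {F : M.OverlapPair N k (M.chain r ∪ S) → Set Ω}
    (hFcode : F.FactorsThrough OverlapPair.code) (hF : ∀ x, MeasurableSet[levelSigma X k] (F x))
    {q : ℝ} (hq : 0 ≤ q)
    (hFq : ∀ x, Pr.real (F x) ≤ q * (M.nominalCard N S / M.nominalCard N (M.block k) ^ 2)) :
    Pr.real {ω | ∃ x : M.OverlapPair N k (M.chain r ∪ S),
      (Confined X C (k - 1) x.1.1 ω ∧ Confined X C (k - 1) x.1.2 ω) ∧ ω ∈ F x} ≤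
      M.pairWindowConst C r k * q := by
  have hw := pairWindowConst_nonneg hcover hC hK r
  have hr := M.nominalCard_pos N (M.chain r)
  have hS := M.nominalCard_pos N S
  have hblock := M.nominalCard_pos N (M.block k)
  have hchain := M.nominalCard_pos N (M.chain (k - 1))
  set p := M.pairWindowConst C r k *
    (M.nominalCard N (M.chain r) / M.nominalCard N (M.chain (k - 1)) ^ 2) *
    (q * (M.nominalCard N S / M.nominalCard N (M.block k) ^ 2)) with hp
  have hp0 : 0 ≤ p := by positivity
  refine (measureReal_exists_le_card_mul (f := OverlapPair.code) (fun x y hxy => ?_) hp0 fun x =>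
    measureReal_pair_confined_inter_le hX hm hcover hN hC hK h x (hF x) (hFq x)).trans
    ((mul_le_mul_of_nonneg_right h.card_code_le hp0).trans_eq ?_)
  · have hagree : ∀ l ≤ k, ∀ i ∈ M.chain l, x.1.1 i = y.1.1 i ∧ x.1.2 i = y.1.2 i :=
      fun l hl i hi => OverlapPair.eq_on_chain_of_code_eq hxy (M.chain_mono hl hi)
    ext ω
    refine and_congr (and_congr (confined_congr fun i hi => (hagree _ (Nat.sub_le k 1) i hi).1)
      (confined_congr fun i hi => (hagree _ (Nat.sub_le k 1) i hi).2)) ?_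
    rw [hFcode hxy]
  · rw [hp, ← M.chain_sub_one_union_block k, block, M.nominalCard_union N Finset.disjoint_sdiff,
      ← block]
    field_simp

lemma measureReal_exists_truncatedPairEvent_le (hirr : M.CondC')
    (hU : (M.shared k (M.chain r ∪ S)).Nonempty) :
    Pr.real {ω | ∃ x : M.OverlapPair N k (M.chain r ∪ S), (Confined X C (k - 1) x.1.1 ω ∧
      Confined X C (k - 1) x.1.2 ω) ∧ ω ∈ truncatedPairEvent X C S x} ≤
      M.pairWindowConst C r k * (M.pairConst C k (M.chain r ∪ S) / √N) := by
  have hlt := h.sharedWeight_lt_Delta hcover hirr hK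
  exact measureReal_exists_overlapPair_inter_le hX hm hcover hN hC hK h
    (truncatedPairEvent_factorsThrough_code C) (fun x => measurableSet_truncatedPairEvent C x)
    (div_nonneg (pairConst_nonneg hcover hK h.one_le hlt) (Real.sqrt_nonneg _))
    fun x => measureReal_truncatedPairEvent_le hX hm hcover hN h.one_le hK hU hC hlt x

lemma measureReal_exists_windowPairEvent_le (hU : ¬ (M.shared k (M.chain r ∪ S)).Nonempty) :
    Pr.real {ω | ∃ x : M.OverlapPair N k (M.chain r ∪ S), (Confined X C (k - 1) x.1.1 ω ∧
      Confined X C (k - 1) x.1.2 ω) ∧ ω ∈ windowPairEvent X C x} ≤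
      M.pairWindowConst C r k * (M.windowConst C k ^ 2 / M.nominalCard N S) := by
  have hS := M.nominalCard_pos N S
  refine measureReal_exists_overlapPair_inter_le hX hm hcover hN hC hK h
    (windowPairEvent_factorsThrough_code C) (fun x => measurableSet_windowPairEvent C x)
    (by positivity) fun x => ?_
  rw [div_mul_div_cancel₀ hS.ne', ← div_pow]
  exact measureReal_pair_levelEnergy_mem_Icc_le hX hm hcover hN hC hK h.one_le fun J hJ =>
    x.exists_ne_of_not_subset (M.subset_of_mem_level hJ) fun hJU =>
      hU ⟨J, Finset.mem_filter.2 ⟨hJ, hJU⟩⟩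

lemma measureReal_exists_overlapPair_confined_le (hirr : M.CondC') :
    Pr.real {ω | ∃ x : M.OverlapPair N k (M.chain r ∪ S),
      Confined X C k x.1.1 ω ∧ Confined X C k x.1.2 ω} ≤ M.overlapBound C k r S N := by
  have hlast : ∀ {σ : M.FullConf N} {ω : Ω}, Confined X C k σ ω →
      levelEnergy X k σ ω ∈ Set.Icc (-C) C := fun hσ =>
    hσ k (Finset.mem_Icc.2 ⟨h.one_le, le_rfl⟩)
  have hinit : ∀ {σ : M.FullConf N} {ω : Ω}, Confined X C k σ ω → Confined X C (k - 1) σ ω :=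
    fun hσ => hσ.mono (Nat.sub_le k 1)
  unfold overlapBound
  split_ifs with hU
  · have hsub : {ω | ∃ x : M.OverlapPair N k (M.chain r ∪ S),
        Confined X C k x.1.1 ω ∧ Confined X C k x.1.2 ω} ⊆
        {ω | ∃ σ, Confined X C (k - 1) σ ω ∧ M.energyCut N k (M.chain r ∪ S) S ≤
          energyOn X (M.shared k (M.chain r ∪ S)) σ ω} ∪
        {ω | ∃ x : M.OverlapPair N k (M.chain r ∪ S), (Confined X C (k - 1) x.1.1 ω ∧
          Confined X C (k - 1) x.1.2 ω) ∧ ω ∈ truncatedPairEvent X C S x} := by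
      rintro ω ⟨x, hσ, hτ⟩
      rcases le_total (M.energyCut N k (M.chain r ∪ S) S)
        (energyOn X (M.shared k (M.chain r ∪ S)) x.1.1 ω) with hcut | hcut
      · exact .inl ⟨x.1.1, hinit hσ, hcut⟩
      · exact .inr ⟨x, ⟨hinit hσ, hinit hτ⟩, hcut, hlast hσ, hlast hτ⟩
    rw [add_div, mul_div_assoc, mul_div_assoc]
    exact (measureReal_mono hsub).trans ((measureReal_union_le _ _).trans (add_le_add
      (measureReal_exists_confined_energyCut_le hX hm hcover hN hC hK h hU)
      (measureReal_exists_truncatedPairEvent_le hX hm hcover hN hC hK h hirr hU)))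
  · rw [mul_div_assoc]
    refine (measureReal_mono ?_).trans
      (measureReal_exists_windowPairEvent_le hX hm hcover hN hC hK h hU)
    rintro ω ⟨x, hσ, hτ⟩
    exact ⟨x, ⟨hinit hσ, hinit hτ⟩, hlast hσ, hlast hτ⟩

end Overlap

end OverlapBound

end GREM

namespace GREM

variable {n : ℕ} {M : GREM n} {N j : ℕ}

section NonultrametricPair

variable {σ τ : M.FullConf N}

lemma exists_agree_iff_mem_chain {m : ℕ} (h : ∀ l ∈ Finset.Icc 1 m,
    (∃ s ∈ M.block l, σ s = τ s) → ∀ i ∈ M.chain l, σ i = τ i) :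
    ∃ r ≤ m, ∀ i ∈ M.chain m, σ i = τ i ↔ i ∈ M.chain r := by
  induction m with
  | zero => exact ⟨0, le_rfl, fun i hi => absurd hi (Finset.notMem_empty i)⟩
  | succ m ih =>
    by_cases hagree : ∃ s ∈ M.block (m + 1), σ s = τ s
    · have hall := h (m + 1) (Finset.mem_Icc.2 ⟨by omega, le_rfl⟩) hagree
      exact ⟨m + 1, le_rfl, fun i hi => iff_of_true (hall i hi) hi⟩
    · obtain ⟨r, hr, hiff⟩ := ih fun l hl => h l (Finset.Icc_subset_Icc_right (Nat.le_succ m) hl)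
      refine ⟨r, hr.trans (Nat.le_succ m), fun i hi => ?_⟩
      by_cases him : i ∈ M.chain m
      · exact hiff i him
      · exact iff_of_false (fun heq => hagree ⟨i, Finset.mem_sdiff.2 ⟨hi, him⟩, heq⟩)
          fun hir => him (M.chain_mono hr hir)

lemma exists_isOverlap (h : ∃ k, 1 ≤ k ∧ k ≤ j ∧ (∃ s ∈ M.block k, σ s = τ s) ∧
    ∃ i ∈ M.chain k, σ i ≠ τ i) :
    ∃ k ≤ j, ∃ r S, M.IsOverlap k r S ∧ ∀ i ∈ M.chain k, σ i = τ i ↔ i ∈ M.chain r ∪ S := by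
  classical
  obtain ⟨hk, hkj, ⟨s, hs, hsστ⟩, q, hq, hqστ⟩ := Nat.find_spec h
  have hmin {l : ℕ} (hl : l < Nat.find h) := Nat.find_min h hl
  set k := Nat.find h
  obtain ⟨r, hr, hiff⟩ : ∃ r ≤ k - 1, ∀ i ∈ M.chain (k - 1), σ i = τ i ↔ i ∈ M.chain r := by
    refine exists_agree_iff_mem_chain fun l hl hagree i hi => ?_
    rw [Finset.mem_Icc] at hl
    by_contra hne
    exact hmin (l := l) (by omega) ⟨hl.1, by omega, hagree, i, hi, hne⟩
  have hunion : ∀ i ∈ M.chain k, σ i = τ i ↔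
      i ∈ M.chain r ∪ (M.block k).filter fun i => σ i = τ i := by
    intro i hi
    rw [Finset.mem_union, Finset.mem_filter]
    rw [← M.chain_sub_one_union_block, Finset.mem_union] at hi
    refine ⟨fun heq => hi.imp (fun hik => (hiff i hik).1 heq) fun hik => ⟨hik, heq⟩, ?_⟩
    rintro (hir | ⟨-, heq⟩)
    · exact (hiff i (M.chain_mono hr hir)).2 hir
    · exact heq
  exact ⟨k, hkj, r, _, ⟨by omega, Finset.filter_subset _ _, ⟨s, Finset.mem_filter.2 ⟨hs, hsστ⟩⟩,
    fun heq => hqστ ((hunion q hq).2 (heq ▸ hq))⟩, hunion⟩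

lemma exists_isOverlap_of_nonultrametric
    (h : M.Nonultrametric j ((M.chain j).restrict σ) ((M.chain j).restrict τ)) :
    ∃ k ≤ j, ∃ r S, M.IsOverlap k r S ∧ ∀ i ∈ M.chain k, σ i = τ i ↔ i ∈ M.chain r ∪ S := by
  obtain ⟨k, hk, hkj, ⟨s, hs, hsστ⟩, q, hq, hqστ⟩ := h
  exact exists_isOverlap ⟨k, hk, hkj, ⟨s.1, hs, hsστ⟩, q.1, hq, hqστ⟩

end NonultrametricPair

open Classical in
variable (M) in
/-- The indices `(k, r, S)` of the possible overlaps in the first `j` levels. -/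
def overlaps (j : ℕ) : Finset (ℕ × ℕ × Finset (Fin n)) :=
  (Finset.range (j + 1) ×ˢ Finset.range (j + 1) ×ˢ Finset.univ).filter
    fun t => M.IsOverlap t.1 t.2.1 t.2.2

lemma mem_overlaps {k r : ℕ} {S : Finset (Fin n)} :
    (k, r, S) ∈ M.overlaps j ↔ k ≤ j ∧ M.IsOverlap k r S := by
  simp only [overlaps, Finset.mem_filter, Finset.mem_product, Finset.mem_range, Finset.mem_univ,
    and_true, Nat.lt_succ_iff]
  exact ⟨fun h => ⟨h.1.1, h.2⟩, fun h => ⟨⟨h.1, h.2.lt.le.trans h.1⟩, h.2⟩⟩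

lemma tendsto_sum_overlapBound (C : ℝ) (j : ℕ) :
    Tendsto (fun N => ∑ t ∈ M.overlaps j, M.overlapBound C t.1 t.2.1 t.2.2 N) atTop (nhds 0) := by
  rw [← Finset.sum_const_zero (s := M.overlaps j)]
  exact tendsto_finsetSum _ fun t ht => tendsto_overlapBound (mem_overlaps.1 ht).2.nonempty

lemma size_pos (i : Fin n) : 0 < M.size N i :=
  Nat.floor_pos.2 (Real.one_le_rpow one_le_two (mul_nonneg (M.γ_pos i).le (Nat.cast_nonneg N)))

lemma restrict_surjective (A : Finset (Fin n)) :
    Function.Surjective (A.restrict : M.FullConf N → M.Conf N A) := by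
  classical
  intro σ
  refine ⟨fun i => if h : i ∈ A then σ ⟨i, h⟩ else ⟨0, size_pos i⟩, funext fun i => ?_⟩
  exact dif_pos i.2

section Disorder

variable {Ω : Type*} {X Y : (J : Finset (Fin n)) → M.Conf N J → Ω → ℝ} {ω : Ω}

lemma energyHat_restrict (j : ℕ) (σ : M.FullConf N) (ω : Ω) :
    M.energyHat X j ((M.chain j).restrict σ) ω = partialEnergy X j σ ω := by
  refine Eq.trans ?_ (Finset.sum_coe_sort (Finset.Icc 1 j) fun l => levelEnergy X l σ ω)
  refine Finset.sum_congr rfl fun l _ => congrArg (· - M.aN N l) ?_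
  exact Finset.sum_coe_sort (M.level l) fun J => X J (J.restrict σ) ω

lemma partialEnergy_congr_disorder (h : ∀ J ∈ M.P Finset.univ, ∀ τ, X J τ ω = Y J τ ω) (j : ℕ)
    (σ : M.FullConf N) : partialEnergy X j σ ω = partialEnergy Y j σ ω :=
  Finset.sum_congr rfl fun l _ => congrArg (· - M.aN N l)
    (Finset.sum_congr rfl fun J hJ => h J (level_subset_P l hJ) _)

variable [MeasurableSpace Ω] {Pr : Measure Ω}

lemma IsDisorder.exists_measurable (hX : M.IsDisorder Pr X) :
    ∃ Y : (J : Finset (Fin n)) → M.Conf N J → Ω → ℝ, M.IsDisorder Pr Y ∧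
      (∀ J τ, Measurable (Y J τ)) ∧ ∀ᵐ ω ∂Pr, ∀ J ∈ M.P Finset.univ, ∀ τ, X J τ ω = Y J τ ω := by
  have hmodify : ∀ J τ, ∃ g : Ω → ℝ, Measurable g ∧ (J ∈ M.P Finset.univ → X J τ =ᵐ[Pr] g) := by
    intro J τ
    by_cases hJ : J ∈ M.P Finset.univ
    · have hmeas := (hX.hasLaw J hJ τ).aemeasurable
      exact ⟨_, hmeas.measurable_mk, fun _ => hmeas.ae_eq_mk⟩
    · exact ⟨0, measurable_zero, fun h => absurd h hJ⟩
  choose Y hm hae using hmodify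
  have hindep := iIndepFun_congr (μ := Pr) (mβ := fun _ => inferInstance)
    (f := fun p : M.DisorderIndex N => X p.1.1 p.2) (g := fun p : M.DisorderIndex N => Y p.1.1 p.2)
    fun p => hae p.1.1 p.2 p.1.2
  refine ⟨Y, ⟨fun J hJ τ => (hX.hasLaw J hJ τ).congr (hae J τ hJ).symm, hindep.1 hX.indep⟩, hm, ?_⟩
  simp only [ae_all_iff]
  exact fun J hJ τ => hae J τ hJ

variable [IsProbabilityMeasure Pr] (hcover : ∀ i : Fin n, ∃ J ∈ M.P Finset.univ, i ∈ J)
  (hirr : M.CondC') (hj : j ≤ M.K) (hN : 0 < N)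

include hcover hirr hj hN

lemma measureReal_exists_overlaps_confined_le (hX : M.IsDisorder Pr X)
    (hm : ∀ J τ, Measurable (X J τ)) {C : ℝ} (hC : 0 ≤ C) :
    Pr.real (⋃ t ∈ M.overlaps j, {ω | ∃ x : M.OverlapPair N t.1 (M.chain t.2.1 ∪ t.2.2),
      Confined X C t.1 x.1.1 ω ∧ Confined X C t.1 x.1.2 ω}) ≤
      ∑ t ∈ M.overlaps j, M.overlapBound C t.1 t.2.1 t.2.2 N := by
  refine (measureReal_biUnion_finset_le _ _).trans (Finset.sum_le_sum fun t ht => ?_)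
  obtain ⟨htj, hoverlap⟩ := mem_overlaps.1 ht
  exact measureReal_exists_overlapPair_confined_le hX hm hcover hN hC (htj.trans hj) hoverlap hirr

lemma measureReal_exists_nonultrametric_le (hX : M.IsDisorder Pr X) {R T L : ℝ} (hR : 0 ≤ R)
    (hT : 0 ≤ T) (hL : 0 ≤ L) :
    Pr.real {ω | ∃ σ τ : M.Conf N (M.chain j), M.Nonultrametric j σ τ ∧
      M.energyHat X j σ ω ∈ Set.Icc (-R) R ∧ M.energyHat X j τ ω ∈ Set.Icc (-R) R} ≤
      M.exitBound j R T L +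
        ∑ t ∈ M.overlaps j, M.overlapBound (2 * (R + T + L)) t.1 t.2.1 t.2.2 N := by
  obtain ⟨Y, hY, hm, hae⟩ := hX.exists_measurable
  set C := 2 * (R + T + L)
  set exit : Set Ω := {ω | ∃ σ, partialEnergy Y j σ ω ∈ Set.Icc (-R) R ∧ ¬ Confined Y C j σ ω}
  set overlap : Set Ω := ⋃ t ∈ M.overlaps j,
    {ω | ∃ x : M.OverlapPair N t.1 (M.chain t.2.1 ∪ t.2.2),
      Confined Y C t.1 x.1.1 ω ∧ Confined Y C t.1 x.1.2 ω}
  have hsub : {ω | ∃ σ τ : M.Conf N (M.chain j), M.Nonultrametric j σ τ ∧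
      M.energyHat X j σ ω ∈ Set.Icc (-R) R ∧ M.energyHat X j τ ω ∈ Set.Icc (-R) R} ≤ᵐ[Pr]
      (exit ∪ overlap : Set Ω) := by
    filter_upwards [hae] with ω hω
    rintro ⟨σ₀, τ₀, hnonultra, hσ, hτ⟩
    obtain ⟨σ, rfl⟩ := restrict_surjective _ σ₀
    obtain ⟨τ, rfl⟩ := restrict_surjective _ τ₀
    rw [energyHat_restrict, partialEnergy_congr_disorder hω] at hσ hτ
    refine or_iff_not_imp_left.2 fun hexit => ?_
    have hconfined : ∀ υ, partialEnergy Y j υ ω ∈ Set.Icc (-R) R → Confined Y C j υ ω :=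
      fun υ hυ => not_not.1 fun hout => hexit ⟨υ, hυ, hout⟩
    obtain ⟨k, hkj, r, S, hoverlap, hiff⟩ := exists_isOverlap_of_nonultrametric hnonultra
    exact Set.mem_biUnion (x := (k, r, S)) (mem_overlaps.2 ⟨hkj, hoverlap⟩)
      ⟨⟨(σ, τ), hiff⟩, (hconfined σ hσ).mono hkj, (hconfined τ hτ).mono hkj⟩
  refine (ENNReal.toReal_mono (measure_ne_top _ _) (measure_mono_ae hsub)).trans
    ((measureReal_union_le _ _).trans (add_le_add ?_ ?_))
  · exact measureReal_not_confined_le hcover hY hm hN hj hR hT hL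
  · exact measureReal_exists_overlaps_confined_le hcover hirr hj hN hY hm (by positivity)

end Disorder

end GREM

end

theorem mainTheorem5_general {n : ℕ} (M : GREM n)
    (hcover : ∀ i : Fin n, ∃ J ∈ M.P Finset.univ, i ∈ J) (hirr : M.CondC')
    (j : ℕ) (hjK : j ≤ M.K) (D : Set ℝ) (hD : Bornology.IsBounded D) (ε : ℝ) (hε : 0 < ε) :
    ∃ N₀ : ℕ, ∀ N ≥ N₀,
      ∀ (Ω : Type*) [MeasurableSpace Ω] (Pr : Measure Ω) [IsProbabilityMeasure Pr]
        (X : (J : Finset (Fin n)) → M.Conf N J → Ω → ℝ), M.IsDisorder Pr X →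
        Pr {ω | ∃ σ τ : M.Conf N (M.chain j), M.Nonultrametric j σ τ ∧
          M.energyHat X j σ ω ∈ D ∧ M.energyHat X j τ ω ∈ D} ≤ ENNReal.ofReal ε := by
  obtain ⟨R, hR, hDR⟩ := hD.exists_pos_norm_le
  obtain ⟨T, L, hT, hL, hexit⟩ := GREM.exists_exitBound_lt hcover hjK R (half_pos hε)
  obtain ⟨N₀, hN₀⟩ := eventually_atTop.1 ((GREM.tendsto_sum_overlapBound
    (M := M) (2 * (R + T + L)) j).eventually_lt_const (half_pos hε))
  refine ⟨max N₀ 1, fun N hN Ω _ Pr _ X hX => ?_⟩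
  have hbound := GREM.measureReal_exists_nonultrametric_le hcover hirr hjK
    ((le_max_right N₀ 1).trans hN) hX hR.le hT hL
  have hoverlap := hN₀ N ((le_max_left N₀ 1).trans hN)
  rw [ENNReal.le_ofReal_iff_toReal_le (measure_ne_top _ _) hε.le]
  refine (measureReal_mono ?_).trans (hbound.trans (by linarith))
  rintro ω ⟨σ, τ, hnonultra, hσ, hτ⟩
  exact ⟨σ, τ, hnonultra, abs_le.1 (hDR _ hσ), abs_le.1 (hDR _ hτ)⟩

theorem mainTheorem5 {n : ℕ} (M : GREM n)
    (hcover : ∀ i : Fin n, ∃ J ∈ M.P Finset.univ, i ∈ J)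
    (hirr : M.Irreducible)
    (j : ℕ) (hj1 : 1 ≤ j) (hjK : j ≤ M.K)
    (D : Set ℝ) (hD : IsCompact D) (ε : ℝ) (hε : 0 < ε) :
    ∃ N₀ : ℕ, ∀ N ≥ N₀,
      ∀ (Ω : Type*) [MeasurableSpace Ω] (Pr : Measure Ω) [IsProbabilityMeasure Pr]
        (X : (J : Finset (Fin n)) → M.Conf N J → Ω → ℝ), M.IsDisorder Pr X →
        Pr {ω | ∃ σ τ : M.Conf N (M.chain j), M.Nonultrametric j σ τ ∧
          M.energyHat X j σ ω ∈ D ∧ M.energyHat X j τ ω ∈ D} ≤ ENNReal.ofReal ε :=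
  mainTheorem5_general M hcover hirr.2 j hjK D hD.isBounded ε hε
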